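/- **Setting.** Let $(X,d,\mu)$ be a bounded (non-empty) metric measure space, i.e. $(X,d)$ is a bounded metric space and $\mu$ is a Borel measure with $0<\mu(B(x,r))<\infty$ for all $x\in X$, $r>0$. Let $\mathcal P(X)$ be the set of measurable $q:X\to(0,\infty]$ with $\operatorname{ess\,inf} q>0$, and let $\mathcal P_b^{\log}(X)$ be the set of essentially bounded $p\in\mathcal P(X)$ such that, for some $C>0$, $|1/p(x)-1/p(y)|\le C/\log(e+1/d(x,y))$ for all $x,y\in X$. Write $f\ll g$ (or $g\gg f$) if $\operatorname{ess\,inf}(g-f)>0$. Assume that there are $Q\in\mathcal P_b^{\log}(X)$, $\delta\in(0,\infty)$, $b\in(0,1]$ with $\mu(B(x,r))\ge b\,r^{Q(x)}$ for all $x\in X$ and $r\in(0,\delta]$, and let $p,s\in\mathcal P_b^{\log}(X)$ and $q\in\mathcal P(X)$. **Norms** (with $\inf\emptyset=\infty$). Let $\rho_{p(\cdot)}(f)=\int_X|f|^{p(x)}\,d\mu$ and $\|f\|_{L^{p(\cdot)}}=\inf\{\lambda>0:\rho_{p(\cdot)}(f/\lambda)\le1\}$, with $f\in L^{p(\cdot)}$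 iff $f$ is measurable and $\rho_{p(\cdot)}(f)<\infty$. For sequences $g=\{g_k\}_{k\in\mathbb Z}$ of measurable functions let $\|g\|_{L^{p(\cdot)}(\ell^{q(\cdot)})}=\big\|\,\|\{g_k(x)\}_k\|_{\ell^{q(x)}}\big\|_{L^{p(\cdot)}}$, with $g\in L^{p(\cdot)}(\ell^{q(\cdot)})$ iff $\|\{g_k(x)\}_k\|_{\ell^{q(x)}}\in L^{p(\cdot)}$. Let $\rho(g)=\sum_{k}\inf\{\lambda>0:\rho_{p(\cdot)}(g_k/\lambda^{1/q(\cdot)})\le1\}$ (with $\lambda^{1/\infty}=1$) and $\|g\|_{\ell^{q(\cdot)}(L^{p(\cdot)})}=\inf\{\lambda>0:\rho(g/\lambda)\le1\}$, with $g\in\ell^{q(\cdot)}(L^{p(\cdot)})$ iff all $g_k\in L^{p(\cdot)}$ and $\rho(g/\lambda)<\infty$ for some $\lambda>0$. **Spaces.** For a measurable, a.e. finite $u:X\to[-\infty,\infty]$ let $\mathbb D^{s(\cdot)}(u)$ be the set of sequences $g=\{g_k\}_{k\in\mathbb Z}$ of measurable $g_k:X\to[0,\infty]$ for which there is a null set $N$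 such that $$|u(x)-u(y)|\le d(x,y)^{s(x)}g_k(x)+d(x,y)^{s(y)}g_k(y)$$ for all $k\in\mathbb Z$ and $x,y\in X\setminus N$ with $2^{-k-1}\le d(x,y)<2^{-k}$. The space $\dot M^{s(\cdot)}_{p(\cdot),q(\cdot)}$ (resp. $\dot N^{s(\cdot)}_{p(\cdot),q(\cdot)}$) consists of all such $u$ with $\inf_{g\in\mathbb D^{s(\cdot)}(u)}\|g\|<\infty$, where $\|\cdot\|$ is the quasi-norm of $L^{p(\cdot)}(\ell^{q(\cdot)})$ (resp. $\ell^{q(\cdot)}(L^{p(\cdot)})$); $M^{s(\cdot)}_{p(\cdot),q(\cdot)}=\dot M^{s(\cdot)}_{p(\cdot),q(\cdot)}\cap L^{p(\cdot)}$ and $N^{s(\cdot)}_{p(\cdot),q(\cdot)}=\dot N^{s(\cdot)}_{p(\cdot),q(\cdot)}\cap L^{p(\cdot)}$. **Theorem.** Write $u_X=\frac1{\mu(X)}\int_Xu\,d\mu$. (i) If $sp\ll Q$, there is a constant $C_S>0$, depending only on $b,\delta,\operatorname{diam}X,\mu(X),p,s,Q$, such that with $\gamma=\frac{Qp}{Q-sp}$,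 for all $u\in\dot M^{s(\cdot)}_{p(\cdot),q(\cdot)}$ and $g\in\mathbb D^{s(\cdot)}(u)\cap L^{p(\cdot)}(\ell^{q(\cdot)})$, $$\inf_{c\in\mathbb R}\|u-c\|_{L^{\gamma(\cdot)}}\le C_S\|g\|_{L^{p(\cdot)}(\ell^{q(\cdot)})},$$ and for all $u\in M^{s(\cdot)}_{p(\cdot),q(\cdot)}$ and $g\in\mathbb D^{s(\cdot)}(u)\cap L^{p(\cdot)}(\ell^{q(\cdot)})$, $$\|u\|_{L^{\gamma(\cdot)}}\le C_S\big(\|u\|_{L^{p(\cdot)}}+\|g\|_{L^{p(\cdot)}(\ell^{q(\cdot)})}\big).$$ (ii) If $sp=Q$, there are constants $C_1,C_2>0$, depending only on $b,\delta,\operatorname{diam}X,p,s,Q$, such that every $u\in\dot M^{s(\cdot)}_{p(\cdot),q(\cdot)}$ admitting a $g\in\mathbb D^{s(\cdot)}(u)\cap L^{p(\cdot)}(\ell^{q(\cdot)})$ with $\|g\|_{L^{p(\cdot)}(\ell^{q(\cdot)})}>0$ is integrable, and for every such $g$ $$\frac1{\mu(X)}\int_X\exp\Big(C_1\frac{|u-u_X|}{\|g\|_{L^{p(\cdot)}(\ell^{q(\cdot)})}}\Big)\,d\mu\le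 C_2.$$ (iii) If $sp\gg Q$, there are constants $C_H,D_H>0$, depending only on $b,\delta,\operatorname{diam}X,p,s,Q$, such that for all $u\in\dot M^{s(\cdot)}_{p(\cdot),q(\cdot)}$ and $g\in\mathbb D^{s(\cdot)}(u)\cap L^{p(\cdot)}(\ell^{q(\cdot)})$ the function $u$ is integrable, $$\|u-u_X\|_{L^\infty}\le C_H\|g\|_{L^{p(\cdot)}(\ell^{q(\cdot)})},$$ and $u$ has a continuous representative $\tilde u$ with $$|\tilde u(x)-\tilde u(y)|\le D_H\|g\|_{L^{p(\cdot)}(\ell^{q(\cdot)})}\,d(x,y)^{\alpha(x)}\quad\text{for all }x,y\in X,\qquad \alpha=s-\frac Qp.$$ If moreover $q\le p$ on $X$, all these statements remain valid with $\dot M,M$ replaced by $\dot N,N$ and $L^{p(\cdot)}(\ell^{q(\cdot)})$ replaced by $\ell^{q(\cdot)}(L^{p(\cdot)})$. -/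

import Mathlib

open MeasureTheory Set
open scoped ENNReal

noncomputable section

namespace HajlaszEmbedding

variable {X : Type*}

/-! ### Variable exponents -/

/-- The class `𝒫(X)` of variable exponents: measurable functions `q : X → (0, ∞]` whose essential
infimum is positive. -/
structure IsVarExponent [MeasurableSpace X] (μ : Measure X) (q : X → ℝ≥0∞) : Prop where
  measurable : Measurable q
  pos : ∀ x, 0 < q x
  essInf_pos : 0 < essInf q μ

/-- The class `𝒫_b(X)` of essentially bounded variable exponents, for finite-valued functions. -/
structure IsBddExponent [MeasurableSpace X] (μ : Measure X) (p : X → ℝ) : Prop where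
  measurable : Measurable p
  pos : ∀ x, 0 < p x
  ess_lower : ∃ a : ℝ, 0 < a ∧ ∀ᵐ x ∂μ, a ≤ p x
  ess_upper : ∃ a : ℝ, ∀ᵐ x ∂μ, p x ≤ a

/-- (Local) log-Hölder continuity on the whole space. For `x = y` the condition is trivial. -/
def LogHolder [MetricSpace X] (f : X → ℝ) : Prop :=
  ∃ C : ℝ, 0 < C ∧ ∀ x y : X, |f x - f y| ≤ C / Real.log (Real.exp 1 + 1 / dist x y)

/-- The class `𝒫_b^log(X)`: bounded exponents `p` such that `1/p` is log-Hölder continuous.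
If every ball has positive measure, then a `(0, ∞]`-valued essentially bounded exponent with
continuous reciprocal is finite everywhere, so that real-valued functions suffice. -/
structure IsBddLogExponent [MetricSpace X] [MeasurableSpace X] (μ : Measure X) (p : X → ℝ) :
    Prop where
  bdd : IsBddExponent μ p
  log : LogHolder (fun x => 1 / p x)

/-- `f ≪ g`, that is, the essential infimum of `g - f` is positive. -/
def MuchLess [MeasurableSpace X] (μ : Measure X) (f g : X → ℝ) : Prop :=
  ∃ a : ℝ, 0 < a ∧ ∀ᵐ x ∂μ, a ≤ g x - f x

/-! ### Metric measure spaces of variable dimension -/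

/-- `(X, d, μ)` is a metric measure space: all balls have positive and finite measure. -/
def IsMetricMeasure [MetricSpace X] [MeasurableSpace X] (μ : Measure X) : Prop :=
  ∀ (x : X) (r : ℝ), 0 < r → 0 < μ (Metric.ball x r) ∧ μ (Metric.ball x r) < ∞

/-- The lower measure bound `μ(B(x, r)) ≥ b r^{Q(x)}` for all `x` and all `r ∈ (0, δ]`. -/
def LowerMeasureBound [MetricSpace X] [MeasurableSpace X] (μ : Measure X) (b δ : ℝ) (Q : X → ℝ) :
    Prop :=
  ∀ (x : X) (r : ℝ), 0 < r → r ≤ δ → ENNReal.ofReal (b * r ^ Q x) ≤ μ (Metric.ball x r)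

/-! ### Variable exponent Lebesgue spaces
Moduli of functions are `[0, ∞]`-valued. -/

/-- The semi-modular `ρ_{p(·)}(f) = ∫ f(x)^{p(x)} dμ(x)`. -/
def modular [MeasurableSpace X] (μ : Measure X) (p : X → ℝ) (f : X → ℝ≥0∞) : ℝ≥0∞ :=
  ∫⁻ x, f x ^ p x ∂μ

/-- The Luxemburg quasi-norm of `L^{p(·)}(X, μ)`; it is `∞` if no `t` is admissible. -/
def lpNorm [MeasurableSpace X] (μ : Measure X) (p : X → ℝ) (f : X → ℝ≥0∞) : ℝ≥0∞ :=
  sInf {t : ℝ≥0∞ | 0 < t ∧ t < ∞ ∧ modular μ p (fun x => f x / t) ≤ 1}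

/-- `f ∈ L^{p(·)}(X, μ)`, for the modulus `f` of a function. -/
def MemLpVar [MeasurableSpace X] (μ : Measure X) (p : X → ℝ) (f : X → ℝ≥0∞) : Prop :=
  Measurable f ∧ modular μ p f < ∞

/-! ### Mixed Lebesgue sequence spaces -/

/-- The pointwise norm `‖{g_k(x)}_k‖_{ℓ^{q(x)}}`. -/
def ellNorm (q : X → ℝ≥0∞) (g : ℤ → X → ℝ≥0∞) (x : X) : ℝ≥0∞ :=
  if q x = ∞ then ⨆ k, g k x else (∑' k, g k x ^ (q x).toReal) ^ (1 / (q x).toReal)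

/-- The semi-modular of `ℓ^{q(·)}(L^{p(·)}(X, μ))`. The exponent `(q x)⁻¹.toReal` is `1 / q(x)`,
and it is `0` for `q(x) = ∞`, so that `t^{1/∞} = 1`. -/
def besovModular [MeasurableSpace X] (μ : Measure X) (p : X → ℝ) (q : X → ℝ≥0∞)
    (g : ℤ → X → ℝ≥0∞) : ℝ≥0∞ :=
  ∑' k, sInf {t : ℝ≥0∞ | 0 < t ∧ t < ∞ ∧
    modular μ p (fun x => g k x / t ^ ((q x)⁻¹).toReal) ≤ 1}

/-- The two scales of spaces: Triebel–Lizorkin (`M`) and Besov (`N`). -/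
inductive Scale
  | triebelLizorkin
  | besov

/-- The quasi-norm of `L^{p(·)}(ℓ^{q(·)}(X, μ))` for the Triebel–Lizorkin scale, and of
`ℓ^{q(·)}(L^{p(·)}(X, μ))` for the Besov scale. -/
def mixedNorm [MeasurableSpace X] (A : Scale) (μ : Measure X) (p : X → ℝ) (q : X → ℝ≥0∞)
    (g : ℤ → X → ℝ≥0∞) : ℝ≥0∞ :=
  match A with
  | .triebelLizorkin => lpNorm μ p (ellNorm q g)
  | .besov => sInf {t : ℝ≥0∞ | 0 < t ∧ t < ∞ ∧ besovModular μ p q (fun k x => g k x / t) ≤ 1}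

/-- Membership in `L^{p(·)}(ℓ^{q(·)}(X, μ))`, respectively in `ℓ^{q(·)}(L^{p(·)}(X, μ))`. -/
def MemMixed [MeasurableSpace X] (A : Scale) (μ : Measure X) (p : X → ℝ) (q : X → ℝ≥0∞)
    (g : ℤ → X → ℝ≥0∞) : Prop :=
  match A with
  | .triebelLizorkin => (∀ k, Measurable (g k)) ∧ MemLpVar μ p (ellNorm q g)
  | .besov => (∀ k, MemLpVar μ p (g k)) ∧
      ∃ t : ℝ≥0∞, 0 < t ∧ t < ∞ ∧ besovModular μ p q (fun k x => g k x / t) < ∞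

/-! ### Hajłasz–Triebel–Lizorkin and Hajłasz–Besov spaces -/

/-- `{g_k}` is a vector `s(·)`-gradient of `u`, that is, `g ∈ 𝔻^{s(·)}(u)`. -/
def IsVectorGradient [MetricSpace X] [MeasurableSpace X] (μ : Measure X) (s : X → ℝ)
    (u : X → EReal) (g : ℤ → X → ℝ≥0∞) : Prop :=
  (∀ k, Measurable (g k)) ∧
  ∃ N : Set X, μ N = 0 ∧ ∀ (k : ℤ) (x y : X), x ∉ N → y ∉ N →
    (2 : ℝ) ^ (-k - 1) ≤ dist x y → dist x y < (2 : ℝ) ^ (-k) →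
    (u x - u y).abs ≤
      ENNReal.ofReal (dist x y ^ s x) * g k x + ENNReal.ofReal (dist x y ^ s y) * g k y

/-- The homogeneous quasi-semi-norm: the infimum of the mixed quasi-norms of the vector
gradients. -/
def homNorm [MetricSpace X] [MeasurableSpace X] (A : Scale) (μ : Measure X) (s p : X → ℝ)
    (q : X → ℝ≥0∞) (u : X → EReal) : ℝ≥0∞ :=
  ⨅ g : {g : ℤ → X → ℝ≥0∞ // IsVectorGradient μ s u g}, mixedNorm A μ p q g.1

/-- The homogeneous space `Ṁ^{s(·)}_{p(·),q(·)}(X, d, μ)`, respectively `Ṅ^{s(·)}_{p(·),q(·)}`. -/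
structure MemHom [MetricSpace X] [MeasurableSpace X] (A : Scale) (μ : Measure X) (s p : X → ℝ)
    (q : X → ℝ≥0∞) (u : X → EReal) : Prop where
  measurable : Measurable u
  ae_finite : ∀ᵐ x ∂μ, u x ≠ ⊤ ∧ u x ≠ ⊥
  homNorm_lt_top : homNorm A μ s p q u < ∞

/-- The inhomogeneous space `M^{s(·)}_{p(·),q(·)}(X, d, μ)`, respectively
`N^{s(·)}_{p(·),q(·)}`. -/
structure MemInhom [MetricSpace X] [MeasurableSpace X] (A : Scale) (μ : Measure X) (s p : X → ℝ)
    (q : X → ℝ≥0∞) (u : X → EReal) : Prop where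
  memHom : MemHom A μ s p q u
  memLp : MemLpVar μ p (fun x => (u x).abs)

/-! ### The setting of the embedding theorem -/

/-- The standing assumptions on the measure and on the exponents `Q, p, s`. -/
structure Setting [MetricSpace X] [MeasurableSpace X] (μ : Measure X) (b δ : ℝ)
    (Q p s : X → ℝ) : Prop where
  metricMeasure : IsMetricMeasure μ
  Q_log : IsBddLogExponent μ Q
  lower : LowerMeasureBound μ b δ Q
  p_log : IsBddLogExponent μ p
  s_log : IsBddLogExponent μ s

/-- The condition on `q`: any variable exponent for the Triebel–Lizorkin scale, and moreover
`q ≤ p` for the Besov scale. -/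
def AdmissibleExponent [MeasurableSpace X] (A : Scale) (μ : Measure X) (p : X → ℝ)
    (q : X → ℝ≥0∞) : Prop :=
  IsVarExponent μ q ∧ (A = Scale.besov → ∀ x, q x ≤ ENNReal.ofReal (p x))

/-- The integral average `u_X` of `u` over the whole space. -/
def mean [MeasurableSpace X] (μ : Measure X) (u : X → EReal) : ℝ :=
  ⨍ x, (u x).toReal ∂μ

end HajlaszEmbedding

end

/-! Let `t` exceed the mixed norm of `g`. The supremum `G = sup_k g_k` is an ordinary Hajłasz
gradient of `u`, and `H = (G / t) ^ p` has integral at most `1`. In the Triebel–Lizorkin scale this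
is `G ≤ ‖g‖_{ℓ^q}`. In the Besov scale `q ≤ p` lets the modular of each `g_k / t` be bounded by its
term in the Besov modular, and the supremum of the `p`-th powers is at most their sum
(`modular_iSup_le_one`, `exists_hajlasz_gradient`).

Put `E_k = {H ≤ 2 ^ k}`, off a null set. By Chebyshev the complement of `E_k` has measure of order
`2 ^ (-k)`, so the lower measure bound forces every ball `B(x, K₀ 2 ^ (-k / Q(x)))` with `k ≥ k₀` to
meet `E_k` (`exists_isLevelFamily`). On `E_k` the rescaled function `u / t` has the Hajłasz gradient
`2 ^ (k / p)`.

A point `x` of `E_k` is joined to `E_{k₀}` by a chain that descends one level at a time. The jump at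
level `i` costs about `(2 ^ (-i / Q)) ^ s * 2 ^ (i / p) = 2 ^ (i β)` with `β = 1 / p - s / Q`.
Log-Hölder continuity makes all exponents along the chain comparable to those at `x`
(`exists_chain`). Everything then reduces to the series of `2 ^ (i β(x))` over `k₀ < i ≤ k`, where
`2 ^ k` is at most a constant times `1 + H(x)`.

If `β > 0`, the last term dominates and the oscillation is at most of order `(1 + H) ^ β` with `β =
1 / γ`, whose `γ`-th power is integrable. If `β = 0`, the sum is at most of order `log (1 + H)`,
which is exponentially integrable. If `β < 0`, the series converges, and stopping the chains of `x`
and `y` at the scale `d(x, y)` gives the Hölder estimate with exponent `-β Q = s - Q / p`. -/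

namespace HajlaszEmbedding

/-! ### Log-Hölder exponents at dyadic scales. -/

section Core

variable {X : Type*} [MetricSpace X]

/-- A dyadic form of log-Hölder continuity: at scale `2 ^ (-i / A)` the oscillation of `f` is
`O(1 / i)`. -/
def IsSlow (A : ℝ) (f : X → ℝ) : Prop :=
  ∀ K : ℝ, ∃ M : ℝ, 0 ≤ M ∧ ∀ (i : ℕ) (x y : X),
    dist x y ≤ K * (2 : ℝ) ^ (-(i / A) : ℝ) → i * |f x - f y| ≤ M

lemma IsSlow.sub {A : ℝ} {f g : X → ℝ} (hf : IsSlow A f) (hg : IsSlow A g) :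
    IsSlow A (fun x => f x - g x) := by
  intro K
  obtain ⟨M, hM, h⟩ := hf K
  obtain ⟨M', hM', h'⟩ := hg K
  refine ⟨M + M', by positivity, fun i x y hxy => ?_⟩
  have h1 := h i x y hxy
  have h2 := h' i x y hxy
  have h3 : |f x - g x - (f y - g y)| ≤ |f x - f y| + |g x - g y| := by
    rw [show f x - g x - (f y - g y) = (f x - f y) - (g x - g y) by ring]
    exact abs_sub _ _
  calc (i : ℝ) * |f x - g x - (f y - g y)| ≤ i * (|f x - f y| + |g x - g y|) := by gcongr
    _ ≤ M + M' := by rw [mul_add]; linarith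

lemma IsSlow.mul {A B : ℝ} {f g : X → ℝ} (hf : IsSlow A f) (hg : IsSlow A g)
    (hfB : ∀ x, |f x| ≤ B) (hgB : ∀ x, |g x| ≤ B) :
    IsSlow A (fun x => f x * g x) := by
  intro K
  obtain ⟨M, hM, h⟩ := hf K
  obtain ⟨M', hM', h'⟩ := hg K
  refine ⟨|B| * M + |B| * M', by positivity, fun i x y hxy => ?_⟩
  have h1 := h i x y hxy
  have h2 := h' i x y hxy
  have h3 : |f x * g x - f y * g y| ≤ |B| * |f x - f y| + |B| * |g x - g y| := by
    rw [show f x * g x - f y * g y = g x * (f x - f y) + f y * (g x - g y) by ring]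
    refine (abs_add_le _ _).trans ?_
    rw [abs_mul, abs_mul]
    have h4 := (hgB x).trans (le_abs_self B)
    have h5 := (hfB y).trans (le_abs_self B)
    exact add_le_add (mul_le_mul_of_nonneg_right h4 (abs_nonneg _))
      (mul_le_mul_of_nonneg_right h5 (abs_nonneg _))
  calc (i : ℝ) * |f x * g x - f y * g y| ≤ i * (|B| * |f x - f y| + |B| * |g x - g y|) := by
        gcongr
    _ = |B| * (i * |f x - f y|) + |B| * (i * |g x - g y|) := by ring
    _ ≤ |B| * M + |B| * M' := by gcongr

lemma IsSlow.inv {A B : ℝ} {f : X → ℝ} (hf : IsSlow A f) (hpos : ∀ x, 0 < f x)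
    (hfB : ∀ x, (f x)⁻¹ ≤ B) : IsSlow A (fun x => (f x)⁻¹) := by
  intro K
  obtain ⟨M, hM, h⟩ := hf K
  refine ⟨|B| * |B| * M, by positivity, fun i x y hxy => ?_⟩
  have h1 := h i x y hxy
  have h3 : |(f x)⁻¹ - (f y)⁻¹| ≤ |B| * |B| * |f x - f y| := by
    have hx := hpos x
    have hy := hpos y
    rw [show (f x)⁻¹ - (f y)⁻¹ = (f x)⁻¹ * (f y)⁻¹ * (f y - f x) by field_simp, abs_mul,
      abs_sub_comm, abs_of_pos (by positivity)]
    gcongr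
    · exact (hfB x).trans (le_abs_self B)
    · exact (hfB y).trans (le_abs_self B)
  calc (i : ℝ) * |(f x)⁻¹ - (f y)⁻¹| ≤ i * (|B| * |B| * |f x - f y|) := by gcongr
    _ = |B| * |B| * (i * |f x - f y|) := by ring
    _ ≤ |B| * |B| * M := by gcongr

/-- At distance `K 2 ^ (-i / A)` the logarithm in the log-Hölder condition is at least `i log 2 / A
- log K`, and it is always at least `1`. Together these bound `i` by a multiple of the logarithm. -/
lemma LogHolder.isSlow {A : ℝ} (hA : 0 < A) {f : X → ℝ} (hf : LogHolder f) : IsSlow A f := by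
  obtain ⟨C, hC, h⟩ := hf
  intro K
  set K' := max K 1 with hK'
  have hK1 : 1 ≤ K' := le_max_right _ _
  have hL : 0 ≤ Real.log K' := Real.log_nonneg hK1
  have hl2 : 0 < Real.log 2 := Real.log_pos one_lt_two
  refine ⟨C * ((1 + Real.log K') * A / Real.log 2), by positivity, fun i x y hxy => ?_⟩
  rcases eq_or_ne x y with rfl | hne
  · simp; positivity
  have hd : 0 < dist x y := dist_pos.2 hne
  set ℓ := Real.log (Real.exp 1 + 1 / dist x y) with hℓ
  have h1 : 1 ≤ ℓ := by
    rw [hℓ, Real.le_log_iff_exp_le (by positivity)]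
    have : 0 < 1 / dist x y := by positivity
    linarith
  have h2 : i * Real.log 2 / A - Real.log K' ≤ ℓ := by
    have e1 : Real.log (dist x y) ≤ Real.log K' - i * Real.log 2 / A := by
      have : dist x y ≤ K' * (2 : ℝ) ^ (-(i / A) : ℝ) := hxy.trans (by gcongr; exact le_max_left _ _)
      have := Real.log_le_log hd this
      rw [Real.log_mul (by positivity) (by positivity), Real.log_rpow two_pos] at this
      calc _ ≤ _ := this
        _ = _ := by ring
    have e2 : -Real.log (dist x y) ≤ ℓ := by
      rw [← Real.log_inv, hℓ]
      apply Real.log_le_log (by positivity)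
      rw [one_div]
      have := Real.exp_pos 1
      linarith
    linarith
  have h3 : (i : ℝ) ≤ (1 + Real.log K') * A / Real.log 2 * ℓ := by
    have : i * Real.log 2 / A ≤ (1 + Real.log K') * ℓ := by nlinarith
    rw [div_le_iff₀ hA] at this
    rw [div_mul_eq_mul_div, le_div_iff₀ hl2]
    linarith
  calc (i : ℝ) * |f x - f y| ≤ i * (C / ℓ) := by gcongr; exact h x y
    _ ≤ ((1 + Real.log K') * A / Real.log 2 * ℓ) * (C / ℓ) := by gcongr
    _ = _ := by field_simp

/-- Two-sided bounds and slow oscillation of the reciprocal exponents `P = 1 / p`, `R = 1 / Q` and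
of the smoothness `s`. -/
structure SlowExponents (A : ℝ) (P s R : X → ℝ) : Prop where
  one_le : 1 ≤ A
  P_mem : ∀ x, P x ∈ Icc A⁻¹ A
  s_mem : ∀ x, s x ∈ Icc A⁻¹ A
  R_mem : ∀ x, R x ∈ Icc A⁻¹ A
  P_slow : IsSlow A P
  s_slow : IsSlow A s
  R_slow : IsSlow A R

/-- An increasing family of sets `E k`, with `E k` being `K₀ 2 ^ (-k / Q)`-dense, such that on `E k`
the function `u` has a Hajłasz gradient of size `2 ^ (k / p)`. -/
structure IsLevelFamily (P s R : X → ℝ) (K₀ : ℝ) (k₀ : ℕ) (E : ℕ → Set X) (u : X → ℝ) :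
    Prop where
  mono : Monotone E
  near : ∀ k, k₀ ≤ k → ∀ x, ∃ y ∈ E k, dist x y ≤ K₀ * (2 : ℝ) ^ (-(k * R x))
  osc : ∀ k, ∀ x ∈ E k, ∀ y ∈ E k,
    |u x - u y| ≤ dist x y ^ s x * (2 : ℝ) ^ (k * P x) + dist x y ^ s y * (2 : ℝ) ^ (k * P y)

variable {A : ℝ} {P s R : X → ℝ}

/-! ### Chaining through the level sets. -/

namespace SlowExponents

lemma pos (hA : SlowExponents A P s R) : 0 < A := zero_lt_one.trans_le hA.one_le

lemma P_pos (hA : SlowExponents A P s R) (x : X) : 0 < P x :=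
  (inv_pos.2 hA.pos).trans_le (hA.P_mem x).1

lemma s_pos (hA : SlowExponents A P s R) (x : X) : 0 < s x :=
  (inv_pos.2 hA.pos).trans_le (hA.s_mem x).1

lemma R_pos (hA : SlowExponents A P s R) (x : X) : 0 < R x :=
  (inv_pos.2 hA.pos).trans_le (hA.R_mem x).1

lemma slow_beta (hA : SlowExponents A P s R) : IsSlow A (fun x => P x - s x * R x) :=
  hA.P_slow.sub (hA.s_slow.mul (B := A) hA.R_slow
    (fun x => by rw [abs_of_pos (hA.s_pos x)]; exact (hA.s_mem x).2)
    (fun x => by rw [abs_of_pos (hA.R_pos x)]; exact (hA.R_mem x).2))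

lemma rpow_R_le (hA : SlowExponents A P s R) (x : X) (i : ℕ) :
    (2 : ℝ) ^ (-(i * R x)) ≤ (2 : ℝ) ^ (-(i / A) : ℝ) := by
  apply Real.rpow_le_rpow_of_exponent_le one_le_two
  rw [neg_le_neg_iff, div_eq_mul_inv]
  gcongr
  exact (hA.R_mem x).1

/-- Slowly oscillating exponents may be frozen at the centre of a ball of the matching scale. -/
lemma exists_rpow_le {f : X → ℝ} (hf : IsSlow A f) (K : ℝ) :
    ∃ C : ℝ, 0 < C ∧ ∀ (i : ℕ) (x y : X), dist x y ≤ K * (2 : ℝ) ^ (-(i / A) : ℝ) →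
      (2 : ℝ) ^ (i * f y) ≤ C * (2 : ℝ) ^ (i * f x) ∧
      (2 : ℝ) ^ (-(i * f y)) ≤ C * (2 : ℝ) ^ (-(i * f x)) := by
  obtain ⟨M, -, h⟩ := hf K
  refine ⟨2 ^ M, by positivity, fun i x y hxy => ?_⟩
  have h1 := h i x y hxy
  have h2 : (i : ℝ) * (f x - f y) ≤ i * |f x - f y| := by gcongr; exact le_abs_self _
  have h3 : (i : ℝ) * (f y - f x) ≤ i * |f x - f y| := by
    rw [abs_sub_comm]; gcongr; exact le_abs_self _
  rw [← Real.rpow_add two_pos, ← Real.rpow_add two_pos]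
  constructor <;> apply Real.rpow_le_rpow_of_exponent_le one_le_two <;> linarith

lemma exists_osc_le (hA : SlowExponents A P s R) (K : ℝ) :
    ∃ C : ℝ, 0 < C ∧ ∀ (K₀ : ℝ) (k₀ : ℕ) (E : ℕ → Set X) (u : X → ℝ),
      IsLevelFamily P s R K₀ k₀ E u → ∀ (i : ℕ) (x y z : X), y ∈ E i → z ∈ E i →
      dist x y ≤ K * (2 : ℝ) ^ (-(i * R x)) → dist x z ≤ K * (2 : ℝ) ^ (-(i * R x)) →
      |u y - u z| ≤ C * (2 : ℝ) ^ (i * (P x - s x * R x)) := by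
  obtain ⟨C₁, hC₁, h₁⟩ := exists_rpow_le hA.P_slow (max K 0)
  obtain ⟨M, hM, hs⟩ := hA.s_slow (max K 0)
  -- Taking `L ≥ 1` allows `L ^ s w ≤ L ^ A`.
  set L := max (2 * K) 1 with hL
  have hL1 : 1 ≤ L := le_max_right _ _
  refine ⟨2 * (L ^ A * 2 ^ (A * M) * C₁), by positivity, ?_⟩
  intro K₀ k₀ E u hE i x y z hy hz hxy hxz
  have key : ∀ w, dist x w ≤ K * (2 : ℝ) ^ (-(i * R x)) →
      dist y z ^ s w * (2 : ℝ) ^ (i * P w) ≤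
        L ^ A * 2 ^ (A * M) * C₁ * (2 : ℝ) ^ (i * (P x - s x * R x)) := by
    intro w hw
    have hw' : dist x w ≤ max K 0 * (2 : ℝ) ^ (-(i / A) : ℝ) := by
      refine hw.trans ?_
      calc K * (2 : ℝ) ^ (-(i * R x)) ≤ max K 0 * (2 : ℝ) ^ (-(i * R x)) := by
            gcongr; exact le_max_left _ _
        _ ≤ _ := by gcongr ?_ * ?_; exact hA.rpow_R_le x i
    have hyz : dist y z ≤ L * (2 : ℝ) ^ (-(i * R x)) := by
      calc dist y z ≤ dist x y + dist x z := dist_triangle_left _ _ _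
        _ ≤ 2 * K * (2 : ℝ) ^ (-(i * R x)) := by linarith
        _ ≤ _ := by gcongr; exact le_max_left _ _
    have e1 : dist y z ^ s w ≤ L ^ A * 2 ^ (A * M) * (2 : ℝ) ^ (-(i * R x * s x)) := by
      calc dist y z ^ s w ≤ (L * (2 : ℝ) ^ (-(i * R x))) ^ s w := by
            gcongr; exact (hA.s_pos w).le
        _ = L ^ s w * (2 : ℝ) ^ (-(i * R x) * s w) := by
            rw [Real.mul_rpow (by positivity) (by positivity), ← Real.rpow_mul (by positivity)]
        _ ≤ L ^ A * (2 : ℝ) ^ (A * M + -(i * R x * s x)) := by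
            gcongr
            · exact (hA.s_mem w).2
            · exact one_le_two
            · have h1 := hs i x w hw'
              have h2 : (i : ℝ) * (s x - s w) ≤ i * |s x - s w| := by
                gcongr; exact le_abs_self _
              have h3 : R x * (i * (s x - s w)) ≤ A * M :=
                calc R x * (i * (s x - s w)) ≤ R x * M := by
                      gcongr
                      · exact (hA.R_pos x).le
                      · linarith
                  _ ≤ A * M := by gcongr; exact (hA.R_mem x).2
              linarith
        _ = _ := by rw [Real.rpow_add two_pos, ← mul_assoc]
    have e2 := (h₁ i x w hw').1
    calc dist y z ^ s w * (2 : ℝ) ^ (i * P w)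
        ≤ (L ^ A * 2 ^ (A * M) * (2 : ℝ) ^ (-(i * R x * s x))) * (C₁ * (2 : ℝ) ^ (i * P x)) := by
          gcongr
      _ = L ^ A * 2 ^ (A * M) * C₁ * ((2 : ℝ) ^ (i * P x) * (2 : ℝ) ^ (-(i * R x * s x))) := by
          ring
      _ = _ := by rw [← Real.rpow_add two_pos]; ring_nf
  have := hE.osc i y hy z hz
  have h1 := key y hxy
  have h2 := key z hxz
  linarith

/-- Each point of level `i + 1` is replaced by a nearby point of level `i`. The jumps decay
geometrically as the level grows, so the last one dominates the total distance, and every exponent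
met on the way can be frozen at the starting point `x`. -/
lemma exists_chain (hA : SlowExponents A P s R) {K₀ : ℝ} (hK₀ : 0 < K₀) :
    ∃ C : ℝ, 0 < C ∧ ∀ (k₀ : ℕ) (E : ℕ → Set X) (u : X → ℝ),
      IsLevelFamily P s R K₀ k₀ E u → ∀ (j k : ℕ) (x : X), k₀ ≤ j → j ≤ k → x ∈ E k →
      ∃ y ∈ E j, dist x y ≤ C * (2 : ℝ) ^ (-(j * R x)) ∧
        |u x - u y| ≤ C * ∑ i ∈ Finset.Ioc j k, (2 : ℝ) ^ (i * (P x - s x * R x)) := by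
  have hApos := hA.pos
  set θ : ℝ := (2 : ℝ) ^ (-A⁻¹) with hθ
  have hθ1 : θ < 1 := Real.rpow_lt_one_of_one_lt_of_neg one_lt_two (by simpa using hApos)
  set K₁ := K₀ / (1 - θ) with hK₁
  have h1θ : 0 < 1 - θ := by linarith
  have hK₁0 : 0 < K₁ := by positivity
  obtain ⟨C₁, hC₁, h₁⟩ := exists_rpow_le hA.R_slow K₁
  obtain ⟨C₂, hC₂, h₂⟩ := exists_rpow_le hA.slow_beta K₁
  obtain ⟨C₃, hC₃, h₃⟩ := hA.exists_osc_le (K₀ * 2 ^ A)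
  set C₄ := K₀ * C₁ / (1 - θ) with hC₄
  have hC₄0 : 0 < C₄ := by positivity
  refine ⟨C₄ + C₃ * C₂, by positivity, ?_⟩
  intro k₀ E u hE j k x hj hjk hx
  -- The crude bound with `1 / A` propagates without comparing exponents. It places `y` close enough
  -- to `x` for the slow oscillation of `R` and of `P - s R` to apply, which then yields the sharp
  -- bound. The constants solve `K₁ θ + K₀ = K₁` and `C₄ θ + K₀ C₁ = C₄`.
  suffices H : ∃ y ∈ E j, dist x y ≤ K₁ * (2 : ℝ) ^ (-(j / A) : ℝ) ∧
      dist x y ≤ C₄ * (2 : ℝ) ^ (-(j * R x)) ∧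
      |u x - u y| ≤ C₃ * C₂ * ∑ i ∈ Finset.Ioc j k, (2 : ℝ) ^ (i * (P x - s x * R x)) by
    obtain ⟨y, hy, -, hd, hu⟩ := H
    refine ⟨y, hy, hd.trans ?_, hu.trans ?_⟩
    · gcongr; nlinarith
    · gcongr; linarith
  induction hjk using Nat.decreasingInduction with
  | self =>
    refine ⟨x, hx, ?_, ?_, ?_⟩
    · simp; positivity
    · simp; positivity
    · simp
  | of_succ j hjk ih =>
    obtain ⟨y, hy, hd1, hd2, hu⟩ := ih (by omega)
    obtain ⟨z, hz, hyz⟩ := hE.near j hj y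
    have hstep : (2 : ℝ) ^ (-((j + 1 : ℕ) / A) : ℝ) = θ * (2 : ℝ) ^ (-(j / A) : ℝ) := by
      rw [hθ, ← Real.rpow_add two_pos]; congr 1; push_cast; field_simp; ring
    have hstepR : (2 : ℝ) ^ (-((j + 1 : ℕ) * R x)) ≤ θ * (2 : ℝ) ^ (-(j * R x)) := by
      rw [hθ, ← Real.rpow_add two_pos]
      apply Real.rpow_le_rpow_of_exponent_le one_le_two
      have := (hA.R_mem x).1
      push_cast; linarith
    have hd1' : dist x y ≤ K₁ * (2 : ℝ) ^ (-(j / A) : ℝ) := by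
      refine hd1.trans ?_
      rw [hstep]
      gcongr
      exact mul_le_of_le_one_left (by positivity) hθ1.le
    refine ⟨z, hz, ?_, ?_, ?_⟩
    · calc dist x z ≤ dist x y + dist y z := dist_triangle _ _ _
        _ ≤ K₁ * (θ * (2 : ℝ) ^ (-(j / A) : ℝ)) + K₀ * (2 : ℝ) ^ (-(j / A) : ℝ) := by
            rw [← hstep]; gcongr
            exact hyz.trans (by gcongr ?_ * ?_; exact hA.rpow_R_le y j)
        _ = (K₁ * θ + K₀) * (2 : ℝ) ^ (-(j / A) : ℝ) := by ring
        _ = _ := by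
            congr 1; rw [hK₁]; field_simp; ring
    · calc dist x z ≤ dist x y + dist y z := dist_triangle _ _ _
        _ ≤ C₄ * (θ * (2 : ℝ) ^ (-(j * R x))) + K₀ * (C₁ * (2 : ℝ) ^ (-(j * R x))) := by
            gcongr
            · exact hd2.trans (by gcongr)
            · exact hyz.trans (by gcongr; exact (h₁ j x y hd1').2)
        _ = (C₄ * θ + K₀ * C₁) * (2 : ℝ) ^ (-(j * R x)) := by ring
        _ = _ := by
            congr 1; rw [hC₄]; field_simp; ring
    -- Both `y` and `z` lie in `E (j + 1)`, so the jump is estimated at level `j + 1`; passing from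
    -- scale `j` to `j + 1` costs at most `2 ^ A`.
    · have hyz' : dist y z ≤ K₀ * 2 ^ A * (2 : ℝ) ^ (-((j + 1 : ℕ) * R y)) := by
        refine hyz.trans ?_
        rw [mul_assoc, ← Real.rpow_add two_pos]
        gcongr
        · exact one_le_two
        · have := (hA.R_mem y).2
          push_cast; linarith
      have e1 := h₃ K₀ k₀ E u hE (j + 1) y y z hy (hE.mono (Nat.le_succ j) hz)
        (by simp; positivity) hyz'
      have e2 := (h₂ (j + 1) x y hd1).1
      have e3 : Finset.Ioc j k = insert (j + 1) (Finset.Ioc (j + 1) k) := by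
        ext i; simp; omega
      rw [e3, Finset.sum_insert (by simp), mul_add]
      calc |u x - u z| ≤ |u x - u y| + |u y - u z| := abs_sub_le _ _ _
        _ ≤ _ := by
          rw [add_comm]
          gcongr
          calc _ ≤ _ := e1
            _ ≤ C₃ * (C₂ * (2 : ℝ) ^ ((j + 1 : ℕ) * (P x - s x * R x))) := by gcongr
            _ = _ := by ring

/-! ### Oscillation in the three regimes of the exponent. -/

lemma beta_le (hA : SlowExponents A P s R) (x : X) : P x - s x * R x ≤ A := by
  have := (hA.P_mem x).2
  have := mul_pos (hA.s_pos x) (hA.R_pos x)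
  linarith

lemma neg_le_beta (hA : SlowExponents A P s R) (x : X) : -(A * A) ≤ P x - s x * R x := by
  have := hA.P_pos x
  have : s x * R x ≤ A * A :=
    mul_le_mul (hA.s_mem x).2 (hA.R_mem x).2 (hA.R_pos x).le hA.pos.le
  linarith

lemma exists_osc_base (hA : SlowExponents A P s R) {D : ℝ} (hD : ∀ x y : X, dist x y ≤ D)
    {K₀ : ℝ} (hK₀ : 0 < K₀) (k₀ : ℕ) :
    ∃ C : ℝ, 0 < C ∧ ∀ (E : ℕ → Set X) (u : X → ℝ), IsLevelFamily P s R K₀ k₀ E u →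
      ∀ (k : ℕ) (x z : X), k₀ ≤ k → x ∈ E k → z ∈ E k₀ →
      |u x - u z| ≤ C * (1 + ∑ i ∈ Finset.Ioc k₀ k, (2 : ℝ) ^ (i * (P x - s x * R x))) := by
  obtain ⟨C₁, hC₁, h₁⟩ := hA.exists_chain hK₀
  -- With this factor the ball of level `k₀` around any point is the whole space, so any two points
  -- of `E k₀` can be compared.
  obtain ⟨C₂, hC₂, h₂⟩ := hA.exists_osc_le (|D| * 2 ^ (k₀ * A))
  refine ⟨C₁ + C₂ * 2 ^ (k₀ * A), by positivity, fun E u hE k x z hk hx hz => ?_⟩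
  obtain ⟨y, hy, -, hxy⟩ := h₁ k₀ E u hE k₀ k x le_rfl hk hx
  have e1 := h₂ K₀ k₀ E u hE k₀ y y z hy hz (by simp; positivity) (by
    rw [mul_assoc, ← Real.rpow_add two_pos]
    refine (hD y z).trans ((le_abs_self D).trans (le_mul_of_one_le_right (abs_nonneg _) ?_))
    apply Real.one_le_rpow one_le_two
    rw [← sub_eq_add_neg, ← mul_sub]
    exact mul_nonneg (Nat.cast_nonneg _) (sub_nonneg.2 (hA.R_mem y).2))
  have e2 : (2 : ℝ) ^ (k₀ * (P y - s y * R y)) ≤ 2 ^ (k₀ * A) := by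
    gcongr
    · exact one_le_two
    · exact hA.beta_le y
  set S := ∑ i ∈ Finset.Ioc k₀ k, (2 : ℝ) ^ (i * (P x - s x * R x)) with hS
  have hS0 : 0 ≤ S := by positivity
  calc |u x - u z| ≤ |u x - u y| + |u y - u z| := abs_sub_le _ _ _
    _ ≤ C₁ * S + C₂ * 2 ^ (k₀ * A) := add_le_add hxy (e1.trans (by gcongr))
    _ ≤ (C₁ + C₂ * 2 ^ (k₀ * A)) * (1 + S) := by
      have : 0 ≤ C₂ * 2 ^ (k₀ * A) * S := by positivity
      linarith

lemma sum_rpow_le_of_pos {β₀ β : ℝ} (h0 : 0 < β₀) (h : β₀ ≤ β) {j k : ℕ} (hjk : j ≤ k) :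
    ∑ i ∈ Finset.Ioc j k, (2 : ℝ) ^ (i * β) ≤ (1 - 2 ^ (-β₀))⁻¹ * 2 ^ (k * β) := by
  have hθ1 : (2 : ℝ) ^ (-β₀) < 1 :=
    Real.rpow_lt_one_of_one_lt_of_neg one_lt_two (by simpa using h0)
  set θ : ℝ := (2 : ℝ) ^ (-β₀) with hθ
  have h1θ : 0 < 1 - θ := by linarith
  induction k, hjk using Nat.le_induction with
  | base => simp; positivity
  | succ k hk ih =>
    rw [Finset.sum_Ioc_succ_top (by omega)]
    have e : (2 : ℝ) ^ (k * β) ≤ θ * 2 ^ ((k + 1 : ℕ) * β) := by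
      rw [hθ, ← Real.rpow_add two_pos]
      apply Real.rpow_le_rpow_of_exponent_le one_le_two
      push_cast; linarith
    calc _ ≤ (1 - θ)⁻¹ * (θ * 2 ^ ((k + 1 : ℕ) * β)) + 2 ^ ((k + 1 : ℕ) * β) := by
          gcongr; exact ih.trans (by gcongr)
      _ = ((1 - θ)⁻¹ * θ + 1) * 2 ^ ((k + 1 : ℕ) * β) := by ring
      _ = _ := by congr 1; field_simp; ring

lemma sum_rpow_le_of_neg {β₀ β : ℝ} (h0 : 0 < β₀) (h : β ≤ -β₀) {j k : ℕ} (hjk : j ≤ k) :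
    ∑ i ∈ Finset.Ioc j k, (2 : ℝ) ^ (i * β) ≤ (1 - 2 ^ (-β₀))⁻¹ * 2 ^ (j * β) := by
  have hθ1 : (2 : ℝ) ^ (-β₀) < 1 :=
    Real.rpow_lt_one_of_one_lt_of_neg one_lt_two (by simpa using h0)
  set θ : ℝ := (2 : ℝ) ^ (-β₀) with hθ
  have hθ0 : 0 < θ := by positivity
  have h1θ : 0 < 1 - θ := by linarith
  -- The claimed bound does not change with `k`, so the induction carries an extra tail term. The
  -- step then amounts to `θ (2 - θ) ≤ 1`.
  suffices H : ∑ i ∈ Finset.Ioc j k, (2 : ℝ) ^ (i * β) + (1 - θ)⁻¹ * 2 ^ (k * β) ≤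
      (1 - θ)⁻¹ * 2 ^ (j * β) by
    have : 0 ≤ (1 - θ)⁻¹ * 2 ^ (k * β) := by positivity
    linarith
  induction k, hjk using Nat.le_induction with
  | base => simp
  | succ k hk ih =>
    rw [Finset.sum_Ioc_succ_top (by omega)]
    have e : (2 : ℝ) ^ ((k + 1 : ℕ) * β) ≤ θ * 2 ^ (k * β) := by
      rw [hθ, ← Real.rpow_add two_pos]
      apply Real.rpow_le_rpow_of_exponent_le one_le_two
      push_cast; linarith
    have e2 : (1 + (1 - θ)⁻¹) * θ ≤ (1 - θ)⁻¹ := by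
      have : (1 + (1 - θ)⁻¹) * θ = (1 - θ)⁻¹ * (2 * θ - θ ^ 2) := by field_simp; ring
      rw [this]
      apply mul_le_of_le_one_right (by positivity)
      nlinarith [sq_nonneg (1 - θ)]
    have e3 : (1 + (1 - θ)⁻¹) * 2 ^ ((k + 1 : ℕ) * β) ≤ (1 - θ)⁻¹ * 2 ^ (k * β) :=
      calc _ ≤ (1 + (1 - θ)⁻¹) * (θ * 2 ^ (k * β)) := by gcongr
        _ = (1 + (1 - θ)⁻¹) * θ * 2 ^ (k * β) := by ring
        _ ≤ _ := by gcongr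
    linarith

lemma exists_osc_subcritical (hA : SlowExponents A P s R) {D : ℝ} (hD : ∀ x y : X, dist x y ≤ D)
    {K₀ : ℝ} (hK₀ : 0 < K₀) (k₀ : ℕ) {β₀ : ℝ} (h0 : 0 < β₀)
    (hβ : ∀ x, β₀ ≤ P x - s x * R x) :
    ∃ C : ℝ, 0 < C ∧ ∀ (E : ℕ → Set X) (u : X → ℝ), IsLevelFamily P s R K₀ k₀ E u →
      ∀ (k : ℕ) (x z : X), k₀ ≤ k → x ∈ E k → z ∈ E k₀ →
      |u x - u z| ≤ C * (2 : ℝ) ^ (k * (P x - s x * R x)) := by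
  obtain ⟨C, hC, h⟩ := hA.exists_osc_base hD hK₀ k₀
  have hθ1 : (2 : ℝ) ^ (-β₀) < 1 :=
    Real.rpow_lt_one_of_one_lt_of_neg one_lt_two (by simpa using h0)
  have h1θ : 0 < 1 - (2 : ℝ) ^ (-β₀) := by linarith
  refine ⟨C * (1 + (1 - 2 ^ (-β₀))⁻¹), by positivity, fun E u hE k x z hk hx hz => ?_⟩
  have e1 : (1 : ℝ) ≤ 2 ^ (k * (P x - s x * R x)) :=
    Real.one_le_rpow one_le_two (mul_nonneg (Nat.cast_nonneg _) (h0.le.trans (hβ x)))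
  have e2 := sum_rpow_le_of_pos h0 (hβ x) hk
  calc _ ≤ _ := h E u hE k x z hk hx hz
    _ ≤ C * (2 ^ (k * (P x - s x * R x)) +
        (1 - 2 ^ (-β₀))⁻¹ * 2 ^ (k * (P x - s x * R x))) := by gcongr
    _ = _ := by ring

lemma exists_osc_critical (hA : SlowExponents A P s R) {D : ℝ} (hD : ∀ x y : X, dist x y ≤ D)
    {K₀ : ℝ} (hK₀ : 0 < K₀) (k₀ : ℕ) (hβ : ∀ x, P x - s x * R x = 0) :
    ∃ C : ℝ, 0 < C ∧ ∀ (E : ℕ → Set X) (u : X → ℝ), IsLevelFamily P s R K₀ k₀ E u →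
      ∀ (k : ℕ) (x z : X), k₀ ≤ k → x ∈ E k → z ∈ E k₀ → |u x - u z| ≤ C * (1 + k) := by
  obtain ⟨C, hC, h⟩ := hA.exists_osc_base hD hK₀ k₀
  refine ⟨C, hC, fun E u hE k x z hk hx hz => ?_⟩
  refine (h E u hE k x z hk hx hz).trans ?_
  gcongr
  simp [hβ x]

lemma exists_osc_supercritical (hA : SlowExponents A P s R) {D : ℝ}
    (hD : ∀ x y : X, dist x y ≤ D) {K₀ : ℝ} (hK₀ : 0 < K₀) (k₀ : ℕ) {β₀ : ℝ} (h0 : 0 < β₀)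
    (hβ : ∀ x, P x - s x * R x ≤ -β₀) :
    ∃ C : ℝ, 0 < C ∧ ∀ (E : ℕ → Set X) (u : X → ℝ), IsLevelFamily P s R K₀ k₀ E u →
      ∀ (k : ℕ) (x z : X), k₀ ≤ k → x ∈ E k → z ∈ E k₀ → |u x - u z| ≤ C := by
  obtain ⟨C, hC, h⟩ := hA.exists_osc_base hD hK₀ k₀
  have hθ1 : (2 : ℝ) ^ (-β₀) < 1 :=
    Real.rpow_lt_one_of_one_lt_of_neg one_lt_two (by simpa using h0)
  have h1θ : 0 < 1 - (2 : ℝ) ^ (-β₀) := by linarith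
  refine ⟨C * (1 + (1 - 2 ^ (-β₀))⁻¹), by positivity, fun E u hE k x z hk hx hz => ?_⟩
  refine (h E u hE k x z hk hx hz).trans ?_
  gcongr
  refine (sum_rpow_le_of_neg h0 (hβ x) hk).trans (mul_le_of_le_one_right (by positivity) ?_)
  apply Real.rpow_le_one_of_one_le_of_nonpos one_le_two
  exact mul_nonpos_of_nonneg_of_nonpos (Nat.cast_nonneg _) (by linarith [hβ x])

/-- The chains from `x` and `y` are stopped at the level `j` whose scale `2 ^ (-j R(x))` matches
`d(x, y)`. The two end points are then neighbours at that level, and both chains as well as the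
final comparison cost `O(2 ^ (j β(x)))`. -/
lemma exists_holder (hA : SlowExponents A P s R) {D : ℝ}
    (hD : ∀ x y : X, dist x y ≤ D) {K₀ : ℝ} (hK₀ : 0 < K₀) (k₀ : ℕ) {β₀ : ℝ} (h0 : 0 < β₀)
    (hβ : ∀ x, P x - s x * R x ≤ -β₀) :
    ∃ C : ℝ, 0 < C ∧ ∀ (E : ℕ → Set X) (u : X → ℝ), IsLevelFamily P s R K₀ k₀ E u →
      ∀ (k : ℕ) (x y : X), x ∈ E k → y ∈ E k →
      |u x - u y| ≤ C * dist x y ^ (s x - P x / R x) := by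
  have hApos := hA.pos
  have hθ1 : (2 : ℝ) ^ (-β₀) < 1 :=
    Real.rpow_lt_one_of_one_lt_of_neg one_lt_two (by simpa using h0)
  have h1θ : 0 < 1 - (2 : ℝ) ^ (-β₀) := by linarith
  set c := (1 - (2 : ℝ) ^ (-β₀))⁻¹ with hc
  have hc0 : 0 < c := by positivity
  obtain ⟨C₁, hC₁, h₁⟩ := hA.exists_chain hK₀
  set K₁ := max 1 (|D| * 2 ^ (k₀ * A)) with hK₁
  have hK₁1 : 1 ≤ K₁ := le_max_left _ _
  obtain ⟨C₂, hC₂, h₂⟩ := exists_rpow_le hA.R_slow K₁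
  obtain ⟨C₃, hC₃, h₃⟩ := exists_rpow_le hA.slow_beta K₁
  obtain ⟨C₄, hC₄, h₄⟩ := hA.exists_osc_le (C₁ + (K₁ + C₁ * C₂))
  refine ⟨(C₁ * c + C₄ + C₁ * (c * C₃)) * 2 ^ (A * A), by positivity, ?_⟩
  intro E u hE k x y hx hy
  rcases eq_or_ne x y with rfl | hne
  · simp; positivity
  have hd : 0 < dist x y := dist_pos.2 hne
  have hR := hA.R_pos x
  have hex : ∃ j : ℕ, k₀ ≤ j ∧ (2 : ℝ) ^ (-((j + 1 : ℕ) * R x)) ≤ dist x y := by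
    have ht : Filter.Tendsto (fun j : ℕ => ((2 : ℝ) ^ (-R x)) ^ j) Filter.atTop (nhds 0) :=
      tendsto_pow_atTop_nhds_zero_of_lt_one (by positivity)
        (Real.rpow_lt_one_of_one_lt_of_neg one_lt_two (by simpa using hR))
    obtain ⟨j, hj, hj'⟩ := ((ht.eventually_lt_const hd).and
      (Filter.eventually_ge_atTop (k₀ + 1))).exists
    obtain ⟨i, rfl⟩ : ∃ i, j = i + 1 := ⟨j - 1, by omega⟩
    refine ⟨i, by omega, ?_⟩
    rw [← Real.rpow_natCast, ← Real.rpow_mul two_pos.le] at hj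
    rw [show -(((i + 1 : ℕ) : ℝ) * R x) = -R x * (i + 1 : ℕ) by ring]
    exact hj.le
  classical
  -- Minimality of `j` gives the opposite bound `d(x, y) ≤ K₁ 2 ^ (-j R(x))`; when `j = k₀` the
  -- diameter bound supplies it.
  obtain ⟨j, ⟨hj0, hj1⟩, hjmin⟩ : ∃ j, (k₀ ≤ j ∧ (2 : ℝ) ^ (-((j + 1 : ℕ) * R x)) ≤ dist x y) ∧
      ∀ i < j, ¬ (k₀ ≤ i ∧ (2 : ℝ) ^ (-((i + 1 : ℕ) * R x)) ≤ dist x y) :=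
    ⟨Nat.find hex, Nat.find_spec hex, fun i hi => Nat.find_min hex hi⟩
  have hdK : dist x y ≤ K₁ * (2 : ℝ) ^ (-(j * R x)) := by
    rcases eq_or_lt_of_le hj0 with rfl | hlt
    · calc dist x y ≤ |D| := (hD x y).trans (le_abs_self D)
        _ ≤ |D| * 2 ^ (k₀ * A) * (2 : ℝ) ^ (-(k₀ * R x)) := by
          rw [mul_assoc, ← Real.rpow_add two_pos]
          refine le_mul_of_one_le_right (abs_nonneg _) ?_
          apply Real.one_le_rpow one_le_two
          rw [← sub_eq_add_neg, ← mul_sub]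
          exact mul_nonneg (Nat.cast_nonneg _) (sub_nonneg.2 (hA.R_mem x).2)
        _ ≤ _ := by gcongr; exact le_max_right _ _
    · obtain ⟨i, rfl⟩ : ∃ i, j = i + 1 := ⟨j - 1, by omega⟩
      have := hjmin i (by omega)
      simp only [not_and, not_le] at this
      refine (this (by omega)).le.trans (le_mul_of_one_le_left (by positivity) hK₁1)
  have hdA : dist x y ≤ K₁ * (2 : ℝ) ^ (-(j / A) : ℝ) :=
    hdK.trans (by gcongr ?_ * ?_; exact hA.rpow_R_le x j)
  -- The stopping level `j` may exceed `k`; since the levels increase, both chains may start from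
  -- level `max j k`.
  have hkm : k ≤ max j k := le_max_right _ _
  obtain ⟨x', hx', hxd, hxu⟩ := h₁ k₀ E u hE j _ x hj0 (le_max_left j k) (hE.mono hkm hx)
  obtain ⟨y', hy', hyd, hyu⟩ := h₁ k₀ E u hE j _ y hj0 (le_max_left j k) (hE.mono hkm hy)
  have hxd' : dist x x' ≤ (C₁ + (K₁ + C₁ * C₂)) * (2 : ℝ) ^ (-(j * R x)) := by
    have : 0 < K₁ + C₁ * C₂ := by positivity
    exact hxd.trans (mul_le_mul_of_nonneg_right (by linarith) (by positivity))
  have hyd' : dist x y' ≤ (C₁ + (K₁ + C₁ * C₂)) * (2 : ℝ) ^ (-(j * R x)) := by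
    calc dist x y' ≤ dist x y + dist y y' := dist_triangle _ _ _
      _ ≤ K₁ * (2 : ℝ) ^ (-(j * R x)) + C₁ * (C₂ * (2 : ℝ) ^ (-(j * R x))) := by
        gcongr
        exact hyd.trans (by gcongr; exact (h₂ j x y hdA).2)
      _ = (K₁ + C₁ * C₂) * (2 : ℝ) ^ (-(j * R x)) := by ring
      _ ≤ _ := mul_le_mul_of_nonneg_right (by linarith) (by positivity)
  have e1 := h₄ K₀ k₀ E u hE j x x' y' hx' hy' hxd' hyd'
  set B := (2 : ℝ) ^ (j * (P x - s x * R x)) with hB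
  have e2 : |u x - u x'| ≤ C₁ * (c * B) :=
    hxu.trans (by gcongr; exact sum_rpow_le_of_neg h0 (hβ x) (le_max_left j k))
  have e3 : |u y - u y'| ≤ C₁ * (c * (C₃ * B)) := by
    refine hyu.trans ?_
    gcongr
    exact (sum_rpow_le_of_neg h0 (hβ y) (le_max_left j k)).trans
      (by gcongr; exact (h₃ j x y hdA).1)
  have e4 : |u x - u y| ≤ (C₁ * c + C₄ + C₁ * (c * C₃)) * B := by
    have a1 : |u x - u y| ≤ |u x - u x'| + |u x' - u y'| + |u y - u y'| := by
      rw [abs_sub_comm (u y) (u y')]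
      calc |u x - u y| ≤ |u x - u x'| + |u x' - u y| := abs_sub_le _ _ _
        _ ≤ |u x - u x'| + (|u x' - u y'| + |u y' - u y|) := by
          gcongr; exact abs_sub_le _ _ _
        _ = _ := by ring
    linarith
  have hα : s x - P x / R x = -(P x - s x * R x) / R x := by field_simp; ring
  have e5 : B ≤ 2 ^ (A * A) * dist x y ^ (s x - P x / R x) := by
    have hα0 : 0 ≤ s x - P x / R x := by
      rw [hα]; exact div_nonneg (by linarith [hβ x]) hR.le
    calc B ≤ 2 ^ (A * A) * (2 : ℝ) ^ ((j + 1 : ℕ) * (P x - s x * R x)) := by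
          rw [← Real.rpow_add two_pos]
          apply Real.rpow_le_rpow_of_exponent_le one_le_two
          have := hA.neg_le_beta x
          push_cast; linarith
      _ = 2 ^ (A * A) * ((2 : ℝ) ^ (-((j + 1 : ℕ) * R x))) ^ (s x - P x / R x) := by
          rw [← Real.rpow_mul two_pos.le, hα]
          congr 2
          field_simp
      _ ≤ _ := by gcongr
  calc _ ≤ _ := e4
    _ ≤ (C₁ * c + C₄ + C₁ * (c * C₃)) * (2 ^ (A * A) * dist x y ^ (s x - P x / R x)) := by
      gcongr
    _ = _ := by ring

end SlowExponents

end Core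

/-! ### Level sets, the lower measure bound, and pointwise control of the exponents. -/

section Measure

variable {X : Type*}

/-- The part of the complement of `N` where `H ≤ 2 ^ k`. -/
def levelSet (N : Set X) (H : X → ℝ≥0∞) (k : ℕ) : Set X := {x | x ∉ N ∧ H x ≤ 2 ^ k}

lemma measure_compl_levelSet_le [MeasurableSpace X] {μ : Measure X} {N : Set X} {H : X → ℝ≥0∞} (hN : μ N = 0) (hH : Measurable H)
    (hH2 : ∫⁻ x, H x ∂μ ≤ 2) (k : ℕ) : μ (levelSet N H k)ᶜ ≤ 2 / 2 ^ k := by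
  have hsub : (levelSet N H k)ᶜ ⊆ N ∪ {x | 2 ^ k ≤ H x} := by
    intro x hx
    simp only [levelSet, mem_compl_iff, mem_ofPred_eq, not_and, not_le] at hx
    by_cases hxN : x ∈ N
    · exact Or.inl hxN
    · exact Or.inr (hx hxN).le
  calc μ (levelSet N H k)ᶜ ≤ μ N + μ {x | 2 ^ k ≤ H x} :=
        (measure_mono hsub).trans (measure_union_le _ _)
    _ = μ {x | 2 ^ k ≤ H x} := by rw [hN, zero_add]
    _ ≤ (∫⁻ x, H x ∂μ) / 2 ^ k :=
      meas_ge_le_lintegral_div hH.aemeasurable (by simp) (by simp)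
    _ ≤ _ := by gcongr

/-- Converts bounds in terms of the level `k` into bounds in terms of `1 + H x`. -/
lemma exists_mem_levelSet {N : Set X} {H : X → ℝ≥0∞} {x : X} (hx : x ∉ N) (hH : H x ≠ ∞)
    (k₀ : ℕ) : ∃ k, k₀ ≤ k ∧ x ∈ levelSet N H k ∧
      (2 : ℝ) ^ k ≤ 2 ^ (k₀ + 1) * (1 + (H x).toReal) := by
  have h0 : 0 ≤ (H x).toReal := ENNReal.toReal_nonneg
  obtain ⟨n, h1, h2⟩ := exists_nat_pow_near (x := 1 + (H x).toReal) (by linarith)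
    (one_lt_two (α := ℝ))
  refine ⟨n + 1 + k₀, by omega, ⟨hx, ?_⟩, ?_⟩
  · rw [← ENNReal.ofReal_toReal hH]
    calc ENNReal.ofReal (H x).toReal ≤ ENNReal.ofReal (2 ^ (n + 1 + k₀)) := by
          apply ENNReal.ofReal_le_ofReal
          have : (2 : ℝ) ^ (n + 1) ≤ 2 ^ (n + 1 + k₀) := pow_le_pow_right₀ one_le_two (by omega)
          linarith
      _ = _ := by rw [ENNReal.ofReal_pow (by norm_num)]; simp
  · calc (2 : ℝ) ^ (n + 1 + k₀) = 2 ^ (k₀ + 1) * 2 ^ n := by ring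
      _ ≤ _ := by gcongr

variable [MetricSpace X]

lemma IsSlow.continuous {A : ℝ} {f : X → ℝ} (hf : IsSlow A f) : Continuous f := by
  obtain ⟨M, hM, h⟩ := hf 1
  rw [Metric.continuous_iff]
  intro x ε hε
  obtain ⟨i, hi⟩ := exists_nat_gt (M / ε)
  have hi0 : (0 : ℝ) < i := (div_nonneg hM hε.le).trans_lt hi
  refine ⟨(2 : ℝ) ^ (-(i / A) : ℝ), by positivity, fun y hy => ?_⟩
  have h1 := h i y x (by rw [one_mul]; exact hy.le)
  rw [div_lt_iff₀ hε] at hi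
  rw [Real.dist_eq]
  nlinarith

variable [MeasurableSpace X] {μ : Measure X}

lemma IsMetricMeasure.isOpenPosMeasure (hμ : IsMetricMeasure μ) : μ.IsOpenPosMeasure := by
  refine ⟨fun U hU ⟨x, hx⟩ h0 => ?_⟩
  obtain ⟨r, hr, hrU⟩ := Metric.isOpen_iff.1 hU x hx
  exact (hμ x r hr).1.ne' (measure_mono_null hrU h0)

/-- Sets of full measure are dense because balls have positive measure. Hence essential bounds on
the continuous exponents hold everywhere, in a form that no longer involves `μ`. -/
lemma IsMetricMeasure.le_of_ae_le (hμ : IsMetricMeasure μ) {f g : X → ℝ} (hf : Continuous f)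
    (hg : Continuous g) (h : ∀ᵐ x ∂μ, f x ≤ g x) (x : X) : f x ≤ g x := by
  have := hμ.isOpenPosMeasure
  have h1 : Dense {x | f x ≤ g x} := Measure.dense_of_ae h
  have h2 : IsClosed {x | f x ≤ g x} := isClosed_le hf hg
  have h3 := h1.closure_eq
  rw [h2.closure_eq] at h3
  exact (h3 ▸ mem_univ x : x ∈ {x | f x ≤ g x})

lemma IsMetricMeasure.univ_lt_top (hμ : IsMetricMeasure μ)
    (hX : Bornology.IsBounded (univ : Set X)) [Nonempty X] : μ univ < ∞ := by
  obtain ⟨x⟩ := ‹Nonempty X›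
  obtain ⟨r, hr, h⟩ := hX.subset_ball_lt 0 x
  exact (measure_mono h).trans_lt (hμ x r hr).2

lemma IsBddLogExponent.continuous_inv {p : X → ℝ} (hp : IsBddLogExponent μ p) :
    Continuous (fun x => (p x)⁻¹) := by
  simpa only [one_div] using (LogHolder.isSlow one_pos hp.log).continuous

lemma IsBddLogExponent.continuous {p : X → ℝ} (hp : IsBddLogExponent μ p) : Continuous p := by
  have := hp.continuous_inv.inv₀ (fun x => (inv_pos.2 (hp.bdd.pos x)).ne')
  exact this.congr fun x => inv_inv (p x)

lemma IsBddLogExponent.exists_bounds {p : X → ℝ} (hp : IsBddLogExponent μ p)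
    (hμ : IsMetricMeasure μ) : ∃ B : ℝ, 1 ≤ B ∧ ∀ x, p x ≤ B ∧ (p x)⁻¹ ≤ B := by
  obtain ⟨a, ha, h1⟩ := hp.bdd.ess_lower
  obtain ⟨c, h2⟩ := hp.bdd.ess_upper
  refine ⟨max 1 (max c a⁻¹), le_max_left _ _, fun x => ⟨?_, ?_⟩⟩
  · exact (hμ.le_of_ae_le hp.continuous continuous_const h2 x).trans (by simp)
  · have := hμ.le_of_ae_le continuous_const hp.continuous h1 x
    exact (inv_anti₀ ha this).trans (by simp)

lemma Setting.exists_slowExponents {b δ : ℝ} {Q p s : X → ℝ} (h : Setting μ b δ Q p s) :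
    ∃ A : ℝ, SlowExponents A (fun x => (p x)⁻¹) s (fun x => (Q x)⁻¹) := by
  obtain ⟨B₁, h₁, hp⟩ := h.p_log.exists_bounds h.metricMeasure
  obtain ⟨B₂, h₂, hs⟩ := h.s_log.exists_bounds h.metricMeasure
  obtain ⟨B₃, h₃, hQ⟩ := h.Q_log.exists_bounds h.metricMeasure
  set A := max B₁ (max B₂ B₃) with hA
  have hA1 : 1 ≤ A := h₁.trans (le_max_left _ _)
  have a1 : B₁ ≤ A := le_max_left _ _
  have a2 : B₂ ≤ A := (le_max_left _ _).trans (le_max_right _ _)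
  have a3 : B₃ ≤ A := (le_max_right _ _).trans (le_max_right _ _)
  have hA0 : 0 < A := zero_lt_one.trans_le hA1
  have p0 := h.p_log.bdd.pos
  have s0 := h.s_log.bdd.pos
  have Q0 := h.Q_log.bdd.pos
  -- The log-Hölder hypothesis concerns `1 / s`, whereas the chain needs `s` itself.
  have hs' : IsSlow A s := by
    have := (LogHolder.isSlow hA0 h.s_log.log).inv (B := A)
      (fun x => by have := s0 x; positivity)
      (fun x => by rw [one_div, inv_inv]; exact (hs x).1.trans a2)
    simpa using this
  refine ⟨A, ?_⟩
  exact {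
    one_le := hA1
    P_mem := fun x => ⟨inv_anti₀ (p0 x) ((hp x).1.trans a1), (hp x).2.trans a1⟩
    s_mem := fun x => ⟨inv_le_of_inv_le₀ (s0 x) ((hs x).2.trans a2), (hs x).1.trans a2⟩
    R_mem := fun x => ⟨inv_anti₀ (Q0 x) ((hQ x).1.trans a3), (hQ x).2.trans a3⟩
    P_slow := by simpa only [one_div] using LogHolder.isSlow hA0 h.p_log.log
    s_slow := hs'
    R_slow := by simpa only [one_div] using LogHolder.isSlow hA0 h.Q_log.log }

/-- Outside of the null set `N`, the function `H ^ (1 / p)` is a Hajłasz gradient of `w`, where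
`∫ H ≤ 2`. -/
structure HasGradientPower (μ : Measure X) (p s : X → ℝ) (N : Set X) (H : X → ℝ≥0∞) (w : X → ℝ) :
    Prop where
  null : μ N = 0
  measurable : Measurable H
  lintegral_le : ∫⁻ x, H x ∂μ ≤ 2
  ne_top : ∀ x ∉ N, H x ≠ ∞
  le : ∀ x ∉ N, ∀ y ∉ N, |w x - w y| ≤ dist x y ^ s x * (H x).toReal ^ (p x)⁻¹ +
    dist x y ^ s y * (H y).toReal ^ (p y)⁻¹

variable {A b δ : ℝ} {Q p s : X → ℝ}

/-- Density of the levels is a comparison of measures: the ball has measure at least `3 / 2 ^ k`,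
the complement of the level set at most `2 / 2 ^ k`. -/
lemma exists_isLevelFamily (hA : SlowExponents A (fun x => (p x)⁻¹) s (fun x => (Q x)⁻¹))
    (hb : 0 < b) (hb1 : b ≤ 1) (hδ : 0 < δ) :
    ∃ K₀ : ℝ, 0 < K₀ ∧ ∃ k₀ : ℕ, ∀ μ : Measure X, LowerMeasureBound μ b δ Q →
      ∀ (N : Set X) (H : X → ℝ≥0∞) (w : X → ℝ), HasGradientPower μ p s N H w →
      IsLevelFamily (fun x => (p x)⁻¹) s (fun x => (Q x)⁻¹) K₀ k₀ (levelSet N H) w := by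
  have hApos := hA.pos
  -- Since `A * Q x ≥ 1` and `3 / b ≥ 1`, one has `b * K₀ ^ Q x ≥ 3` at every point.
  set K₀ : ℝ := (3 / b) ^ A with hK₀
  have h3b : 1 ≤ 3 / b := by rw [le_div_iff₀ hb]; linarith
  have hK₀pos : 0 < K₀ := by positivity
  have ht : Filter.Tendsto (fun k : ℕ => K₀ * ((2 : ℝ) ^ (-A⁻¹)) ^ k) Filter.atTop
      (nhds (K₀ * 0)) :=
    (tendsto_pow_atTop_nhds_zero_of_lt_one (by positivity)
      (Real.rpow_lt_one_of_one_lt_of_neg one_lt_two (by simpa using hApos))).const_mul _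
  rw [mul_zero] at ht
  -- From level `k₀` on, the radii are at most `δ`, where the lower measure bound is available.
  obtain ⟨k₀, hk₀⟩ := Filter.eventually_atTop.1 (ht.eventually_lt_const hδ)
  refine ⟨K₀, hK₀pos, k₀, fun μ hμ N H w ⟨hN, hH, hH2, _, hw⟩ => ⟨?_, ?_, ?_⟩⟩
  · intro i j hij x hx
    exact ⟨hx.1, hx.2.trans (pow_le_pow_right₀ (by norm_num) hij)⟩
  · intro k hk x
    set r := K₀ * (2 : ℝ) ^ (-(k * (Q x)⁻¹)) with hr
    have hr0 : 0 < r := by positivity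
    have hQ0 : 0 < Q x := inv_pos.1 (hA.R_pos x)
    have hrδ : r ≤ δ := by
      refine le_trans ?_ (hk₀ k hk).le
      rw [hr]
      gcongr
      rw [← Real.rpow_natCast, ← Real.rpow_mul two_pos.le]
      refine (hA.rpow_R_le x k).trans_eq ?_
      congr 1; field_simp
    have hball := hμ x r hr0 hrδ
    have hlow : 3 / 2 ^ k ≤ b * r ^ Q x := by
      have e1 : r ^ Q x = (3 / b) ^ (A * Q x) * (2 ^ k)⁻¹ := by
        rw [hr, Real.mul_rpow (by positivity) (by positivity), hK₀, ← Real.rpow_mul (by positivity),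
          ← Real.rpow_mul (by positivity), neg_mul, mul_assoc, inv_mul_cancel₀ hQ0.ne', mul_one,
          Real.rpow_neg two_pos.le, Real.rpow_natCast]
      have e2 : 3 / b ≤ (3 / b) ^ (A * Q x) := by
        apply Real.self_le_rpow_of_one_le h3b
        have := (hA.R_mem x).2
        rw [inv_le_iff_one_le_mul₀ hQ0] at this
        exact this
      rw [e1]
      calc (3 : ℝ) / 2 ^ k = b * (3 / b * (2 ^ k)⁻¹) := by field_simp
        _ ≤ _ := by gcongr
    have hlt : μ (levelSet N H k)ᶜ < μ (Metric.ball x r) := by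
      refine (measure_compl_levelSet_le hN hH hH2 k).trans_lt (lt_of_lt_of_le ?_ hball)
      have e3 : (2 : ℝ≥0∞) / 2 ^ k = ENNReal.ofReal (2 / 2 ^ k) := by
        rw [ENNReal.ofReal_div_of_pos (by positivity), ENNReal.ofReal_pow (by norm_num)]
        simp
      rw [e3, ENNReal.ofReal_lt_ofReal_iff_of_nonneg (by positivity)]
      refine lt_of_lt_of_le ?_ hlow
      gcongr
      norm_num
    obtain ⟨y, hy, hy'⟩ : ∃ y ∈ Metric.ball x r, y ∉ (levelSet N H k)ᶜ := by
      by_contra! hcon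
      exact absurd (measure_mono (μ := μ) (fun y hy => hcon y hy)) (not_le.2 hlt)
    exact ⟨y, by simpa using hy', by rw [dist_comm]; exact (Metric.mem_ball.1 hy).le⟩
  · intro k x hx y hy
    have key : ∀ z ∈ levelSet N H k, (H z).toReal ^ (p z)⁻¹ ≤ (2 : ℝ) ^ (k * (p z)⁻¹) := by
      intro z hz
      have : (H z).toReal ≤ 2 ^ k := by
        have := ENNReal.toReal_mono (by simp) hz.2
        simpa using this
      calc (H z).toReal ^ (p z)⁻¹ ≤ ((2 : ℝ) ^ k) ^ (p z)⁻¹ := by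
            gcongr; exact (hA.P_pos z).le
        _ = _ := by rw [← Real.rpow_natCast, ← Real.rpow_mul two_pos.le]
    refine (hw x hx.1 y hy.1).trans ?_
    gcongr
    · exact key x hx
    · exact key y hy

end Measure

/-! ### From the mixed norms to a single integrable majorant. -/

section Norms

variable {X : Type*}

lemma le_ellNorm {q : X → ℝ≥0∞} {x : X} (hq : 0 < q x) (g : ℤ → X → ℝ≥0∞) (k : ℤ) :
    g k x ≤ ellNorm q g x := by
  unfold ellNorm
  split_ifs with h
  · exact le_iSup (fun k => g k x) k
  · have h0 : 0 < (q x).toReal := ENNReal.toReal_pos hq.ne' h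
    rw [one_div, ENNReal.le_rpow_inv_iff h0]
    exact ENNReal.le_tsum (f := fun k => g k x ^ (q x).toReal) k

variable [MeasurableSpace X] {μ : Measure X} {p : X → ℝ} {q : X → ℝ≥0∞}

lemma modular_mono (hp : ∀ x, 0 < p x) {f g : X → ℝ≥0∞} (h : ∀ᵐ x ∂μ, f x ≤ g x) :
    modular μ p f ≤ modular μ p g :=
  lintegral_mono_ae (h.mono fun x hx => ENNReal.rpow_le_rpow hx (hp x).le)

lemma modular_div_le (hp : ∀ x, 0 < p x) {t M : ℝ≥0∞} {f : X → ℝ≥0∞}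
    (h : ∀ x, M ≤ t ^ p x) (hM : M ≠ 0) :
    modular μ p (fun x => f x / t) ≤ modular μ p f / M := by
  unfold modular
  rw [div_eq_mul_inv, ← lintegral_mul_const' _ _ (ENNReal.inv_ne_top.2 hM)]
  refine lintegral_mono fun x => ?_
  rw [ENNReal.div_rpow_of_nonneg _ _ (hp x).le, div_eq_mul_inv]
  gcongr
  exact h x

lemma lpNorm_lt_top {a : ℝ} (ha : 0 < a) (hp : ∀ x, a ≤ p x) {f : X → ℝ≥0∞}
    (hf : modular μ p f < ∞) : lpNorm μ p f < ∞ := by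
  set M := max 1 (modular μ p f) with hM
  have hM1 : 1 ≤ M := le_max_left _ _
  have hMt : M ≠ ∞ := (max_lt ENNReal.one_lt_top hf).ne
  have hM0 : M ≠ 0 := (zero_lt_one.trans_le hM1).ne'
  have ht : M ^ a⁻¹ ≠ ∞ := ENNReal.rpow_ne_top_of_nonneg (by positivity) hMt
  refine lt_of_le_of_lt (sInf_le ⟨ENNReal.rpow_pos (pos_iff_ne_zero.2 hM0) hMt, ht.lt_top, ?_⟩)
    ht.lt_top
  refine (modular_div_le (fun x => ha.trans_le (hp x)) (M := M) (fun x => ?_) hM0).trans ?_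
  · rw [← ENNReal.rpow_mul]
    refine (ENNReal.rpow_one M).symm.le.trans (ENNReal.rpow_le_rpow_of_exponent_le hM1 ?_)
    rw [inv_mul_eq_div, le_div_iff₀ ha, one_mul]
    exact hp x
  · exact ENNReal.div_le_of_le_mul (by rw [one_mul]; exact le_max_right _ _)

/-- Here `e` stands for `1 / q`, and the condition on `e` is `q ≤ p`. It gives `e p ≥ 1`, hence `τ ^
(e p) ≤ τ` for `τ ≤ 1`, and the factor `τ` leaves the integral. -/
lemma modular_le_of_div_rpow_le_one {τ : ℝ≥0∞} {e : X → ℝ} (hp : ∀ x, 0 < p x)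
    (he : ∀ x, (p x)⁻¹ ≤ e x) (hτ0 : τ ≠ 0) (hτ1 : τ ≤ 1) {f : X → ℝ≥0∞}
    (h : modular μ p (fun x => f x / τ ^ e x) ≤ 1) : modular μ p f ≤ τ := by
  have hτt : τ ≠ ∞ := (hτ1.trans_lt ENNReal.one_lt_top).ne
  calc modular μ p f ≤ ∫⁻ x, (f x / τ ^ e x) ^ p x * τ ∂μ := by
        refine lintegral_mono fun x => ?_
        have e0 : 1 ≤ e x * p x := by
          have := mul_le_mul_of_nonneg_right (he x) (hp x).le
          rwa [inv_mul_cancel₀ (hp x).ne'] at this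
        have e1 : τ ^ (e x * p x) ≤ τ := by
          simpa using ENNReal.rpow_le_rpow_of_exponent_ge hτ1 e0
        have e2 : τ ^ (e x * p x) ≠ 0 := (ENNReal.rpow_pos (pos_iff_ne_zero.2 hτ0) hτt).ne'
        rw [ENNReal.div_rpow_of_nonneg _ _ (hp x).le, ← ENNReal.rpow_mul, div_eq_mul_inv, mul_assoc]
        refine le_mul_of_one_le_right (zero_le) ?_
        rw [mul_comm, ← div_eq_mul_inv, ENNReal.le_div_iff_mul_le (Or.inl e2)
          (Or.inr hτt), one_mul]
        exact e1
    _ = modular μ p (fun x => f x / τ ^ e x) * τ := lintegral_mul_const' _ _ hτt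
    _ ≤ τ := mul_le_of_le_one_left (zero_le) h

/-- If `τ` is admissible for a term on the right, then `τ / M` is admissible on the left, because `M
^ (1 / q) ≤ M ^ (1 / c)`. -/
lemma besovModular_div_le (hp : ∀ x, 0 < p x) {c : ℝ} (hc : 0 < c)
    (hq : ∀ᵐ x ∂μ, ENNReal.ofReal c ≤ q x) {t M : ℝ≥0∞} (ht0 : t ≠ 0) (ht : t ≠ ∞) (hM1 : 1 ≤ M)
    (hM : M ≠ ∞) (g : ℤ → X → ℝ≥0∞) :
    besovModular μ p q (fun k x => g k x / (t * M ^ c⁻¹)) ≤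
      besovModular μ p q (fun k x => g k x / t) / M := by
  have hM0 : M ≠ 0 := (zero_lt_one.trans_le hM1).ne'
  unfold besovModular
  rw [div_eq_mul_inv, ← ENNReal.tsum_mul_right]
  refine ENNReal.tsum_le_tsum fun k => ?_
  rw [← div_eq_mul_inv, ENNReal.le_div_iff_mul_le (Or.inl hM0) (Or.inl hM)]
  refine le_sInf fun τ hτ' => ?_
  obtain ⟨hτ0, hτ, h1⟩ := hτ'
  rw [← ENNReal.le_div_iff_mul_le (Or.inl hM0) (Or.inl hM)]
  refine sInf_le ⟨?_, ?_, ?_⟩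
  · exact ENNReal.div_pos hτ0.ne' hM
  · exact ENNReal.div_lt_top hτ.ne hM0
  refine (modular_mono hp ?_).trans h1
  filter_upwards [hq] with x hx
  set e := ((q x)⁻¹).toReal with he
  have he0 : 0 ≤ e := ENNReal.toReal_nonneg
  have hec : e ≤ c⁻¹ := by
    have h2 : (ENNReal.ofReal c)⁻¹ ≠ ∞ := ENNReal.inv_ne_top.2 (by simpa using hc)
    have h3 := ENNReal.toReal_mono h2 (ENNReal.inv_le_inv.2 hx)
    rwa [ENNReal.toReal_inv (ENNReal.ofReal c), ENNReal.toReal_ofReal hc.le] at h3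
  have hτe0 : τ ^ e ≠ 0 := (ENNReal.rpow_pos hτ0 hτ.ne).ne'
  have hτe : τ ^ e ≠ ∞ := ENNReal.rpow_ne_top_of_nonneg he0 hτ.ne
  have hMe0 : M ^ e ≠ 0 := (ENNReal.rpow_pos (pos_iff_ne_zero.2 hM0) hM).ne'
  have hMe : M ^ e ≠ ∞ := ENNReal.rpow_ne_top_of_nonneg he0 hM
  have hMc0 : M ^ c⁻¹ ≠ 0 := (ENNReal.rpow_pos (pos_iff_ne_zero.2 hM0) hM).ne'
  have hMc : M ^ c⁻¹ ≠ ∞ := ENNReal.rpow_ne_top_of_nonneg (by positivity) hM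
  have key : t * τ ^ e ≤ t * M ^ c⁻¹ * (τ ^ e / M ^ e) := by
    calc t * τ ^ e = t * (M ^ e * (τ ^ e / M ^ e)) := by
          rw [ENNReal.mul_div_cancel hMe0 hMe]
      _ ≤ t * (M ^ c⁻¹ * (τ ^ e / M ^ e)) := by
          gcongr
      _ = _ := by rw [mul_assoc]
  rw [ENNReal.div_rpow_of_nonneg _ _ he0]
  simp only [div_eq_mul_inv (g k x)]
  rw [div_eq_mul_inv, div_eq_mul_inv (g k x * t⁻¹), mul_assoc, mul_assoc]
  rw [← ENNReal.mul_inv (Or.inl (mul_ne_zero ht0 hMc0)) (Or.inl (ENNReal.mul_ne_top ht hMc)),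
    ← ENNReal.mul_inv (Or.inl ht0) (Or.inl ht)]
  gcongr

lemma IsVarExponent.exists_lower (hq : IsVarExponent μ q) :
    ∃ c : ℝ, 0 < c ∧ ∀ᵐ x ∂μ, ENNReal.ofReal c ≤ q x := by
  have h0 := hq.essInf_pos
  have hm : min 1 (essInf q μ) ≠ ∞ := (min_lt_of_left_lt ENNReal.one_lt_top).ne
  refine ⟨(min 1 (essInf q μ)).toReal, ENNReal.toReal_pos ?_ hm, ?_⟩
  · exact (lt_min zero_lt_one h0).ne'
  · filter_upwards [ae_essInf_le (f := q) (μ := μ)] with x hx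
    rw [ENNReal.ofReal_toReal hm]
    exact (min_le_right _ _).trans hx

lemma mixedNorm_lt_top {a : ℝ} (ha : 0 < a) (hp : ∀ x, a ≤ p x) {A : Scale}
    (hq : AdmissibleExponent A μ p q) {g : ℤ → X → ℝ≥0∞} (hg : MemMixed A μ p q g) :
    mixedNorm A μ p q g < ∞ := by
  cases A with
  | triebelLizorkin => exact lpNorm_lt_top ha hp hg.2.2
  | besov =>
    obtain ⟨c, hc, hqc⟩ := hq.1.exists_lower
    obtain ⟨-, t, ht0, ht, h⟩ := hg
    set S := besovModular μ p q (fun k x => g k x / t) with hS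
    set M := max 1 S with hM
    have hM1 : 1 ≤ M := le_max_left _ _
    have hMt : M ≠ ∞ := (max_lt ENNReal.one_lt_top h).ne
    have hM0 : M ≠ 0 := (zero_lt_one.trans_le hM1).ne'
    have hMc0 : M ^ c⁻¹ ≠ 0 := (ENNReal.rpow_pos (pos_iff_ne_zero.2 hM0) hMt).ne'
    have hMc : M ^ c⁻¹ ≠ ∞ := ENNReal.rpow_ne_top_of_nonneg (by positivity) hMt
    have hT : t * M ^ c⁻¹ < ∞ := (ENNReal.mul_ne_top ht.ne hMc).lt_top
    refine lt_of_le_of_lt (sInf_le ⟨pos_iff_ne_zero.2 (mul_ne_zero ht0.ne' hMc0), hT, ?_⟩) hT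
    refine (besovModular_div_le (fun x => ha.trans_le (hp x)) hc hqc ht0.ne' ht.ne hM1 hMt
      g).trans ?_
    exact ENNReal.div_le_of_le_mul (by rw [one_mul]; exact le_max_right _ _)

lemma modular_iSup_le_one (hp : ∀ x, 0 < p x) (hpm : Measurable p) {A : Scale}
    (hq : AdmissibleExponent A μ p q)
    {g : ℤ → X → ℝ≥0∞} (hg : ∀ k, Measurable (g k)) {T : ℝ≥0∞} (hT : T ≠ ∞)
    (h : mixedNorm A μ p q g < T) : modular μ p (fun x => (⨆ k, g k x) / T) ≤ 1 := by
  cases A with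
  | triebelLizorkin =>
    obtain ⟨t, ⟨ht0, ht, h1⟩, htT⟩ := sInf_lt_iff.1 h
    refine (modular_mono hp (.of_forall fun x => ?_)).trans h1
    gcongr
    exact iSup_le fun k => le_ellNorm (hq.1.pos x) g k
  | besov =>
    obtain ⟨c, hc, hqc⟩ := hq.1.exists_lower
    obtain ⟨t, ⟨ht0, ht, h1⟩, htT⟩ := sInf_lt_iff.1 h
    -- The gap between `t` and `T` makes the modular of `g / T` strictly less than `1`, so every
    -- term has an admissible `σ < 1`. This `σ` handles the competitors `τ ≥ 1`, to which
    -- `modular_le_of_div_rpow_le_one` does not apply.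
    have hTt : 1 < T / t := by
      rwa [ENNReal.lt_div_iff_mul_lt (Or.inl ht0.ne') (Or.inl ht.ne), one_mul]
    have hTt' : T / t ≠ ∞ := (ENNReal.div_lt_top hT ht0.ne').ne
    set M := (T / t) ^ c with hM
    have hM1 : 1 < M := ENNReal.one_lt_rpow hTt hc
    have hMt : M ≠ ∞ := ENNReal.rpow_ne_top_of_nonneg hc.le hTt'
    have h2 : besovModular μ p q (fun k x => g k x / T) ≤ 1 / M := by
      have h3 := besovModular_div_le hp hc hqc ht0.ne' ht.ne hM1.le hMt g
      rw [hM, ENNReal.rpow_rpow_inv hc.ne', ENNReal.mul_div_cancel ht0.ne' ht.ne] at h3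
      exact h3.trans (by gcongr)
    have h3 : 1 / M < 1 := by
      rw [one_div]; exact ENNReal.inv_lt_one.2 hM1
    have hk : ∀ k, modular μ p (fun x => g k x / T) ≤ sInf {t : ℝ≥0∞ | 0 < t ∧ t < ∞ ∧
        modular μ p (fun x => g k x / T / t ^ ((q x)⁻¹).toReal) ≤ 1} := by
      intro k
      have h4 := ((ENNReal.le_tsum k).trans h2).trans_lt h3
      refine le_sInf fun τ ⟨hτ0, hτ, hτ1⟩ => ?_
      obtain ⟨σ, ⟨hσ0, hσ, hσ1⟩, hσ2⟩ := sInf_lt_iff.1 h4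
      have he : ∀ x, (p x)⁻¹ ≤ ((q x)⁻¹).toReal := by
        intro x
        have h5 := ENNReal.toReal_mono (ENNReal.inv_ne_top.2 (hq.1.pos x).ne')
          (ENNReal.inv_le_inv.2 (hq.2 rfl x))
        rwa [ENNReal.toReal_inv (ENNReal.ofReal _), ENNReal.toReal_ofReal (hp x).le] at h5
      rcases le_total τ 1 with h6 | h6
      · exact modular_le_of_div_rpow_le_one hp he hτ0.ne' h6 hτ1
      · exact (modular_le_of_div_rpow_le_one hp he hσ0.ne' hσ2.le hσ1).trans (hσ2.le.trans h6)
    calc modular μ p (fun x => (⨆ k, g k x) / T)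
        ≤ ∫⁻ x, ∑' k, (g k x / T) ^ p x ∂μ := by
          refine lintegral_mono fun x => ?_
          rw [← ENNReal.le_rpow_inv_iff (hp x)]
          beta_reduce
          rw [ENNReal.iSup_div]
          refine iSup_le fun k => ?_
          rw [ENNReal.le_rpow_inv_iff (hp x)]
          exact ENNReal.le_tsum (f := fun k => (g k x / T) ^ p x) k
      _ = ∑' k, modular μ p (fun x => g k x / T) :=
          lintegral_tsum fun k => (((hg k).div_const T).pow hpm).aemeasurable
      _ ≤ besovModular μ p q (fun k x => g k x / T) := ENNReal.tsum_le_tsum hk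
      _ ≤ 1 := h2.trans h3.le

lemma exists_hajlasz_gradient [MetricSpace X] {s : X → ℝ} (hp : ∀ x, 0 < p x) (hpm : Measurable p)
    {u : X → EReal} (hu : ∀ᵐ x ∂μ, u x ≠ ⊤ ∧ u x ≠ ⊥) {g : ℤ → X → ℝ≥0∞}
    (hg : IsVectorGradient μ s u g) {t : ℝ} (ht : 0 < t)
    (hG : modular μ p (fun x => (⨆ k, g k x) / ENNReal.ofReal t) ≤ 1) :
    ∃ (H : X → ℝ≥0∞) (N : Set X), Measurable H ∧ ∫⁻ x, H x ∂μ ≤ 1 ∧ μ N = 0 ∧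
      (∀ x ∉ N, (u x ≠ ⊤ ∧ u x ≠ ⊥) ∧ H x ≠ ∞) ∧
      ∀ x ∉ N, ∀ y ∉ N, |(u x).toReal / t - (u y).toReal / t| ≤
        dist x y ^ s x * (H x).toReal ^ (p x)⁻¹ + dist x y ^ s y * (H y).toReal ^ (p y)⁻¹ := by
  obtain ⟨hgm, N₀, hN₀, hgrad⟩ := hg
  set H : X → ℝ≥0∞ := fun x => ((⨆ k, g k x) / ENNReal.ofReal t) ^ p x with hH
  have hHm : Measurable H := ((Measurable.iSup hgm).div_const _).pow hpm
  have hHt : ∀ᵐ x ∂μ, H x < ∞ := ae_lt_top hHm (hG.trans_lt ENNReal.one_lt_top).ne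
  refine ⟨H, N₀ ∪ ({x | ¬ (u x ≠ ⊤ ∧ u x ≠ ⊥)} ∪ {x | ¬ H x < ∞}), hHm, hG, ?_, ?_, ?_⟩
  · exact measure_union_null hN₀ (measure_union_null (ae_iff.1 hu) (ae_iff.1 hHt))
  · intro x hx
    simp only [mem_union, mem_ofPred_eq, not_or, not_not] at hx
    exact ⟨hx.2.1, hx.2.2.ne⟩
  · intro x hx y hy
    simp only [mem_union, mem_ofPred_eq, not_or, not_not] at hx hy
    rcases eq_or_ne x y with rfl | hne
    · simp; positivity
    have hd : 0 < dist x y := dist_pos.2 hne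
    have hfin : ∀ z, H z < ∞ → (⨆ k, g k z) ≠ ∞ ∧
        (H z).toReal ^ (p z)⁻¹ = (⨆ k, g k z).toReal / t := by
      intro z hz
      constructor
      · intro h
        simp [hH, h, ENNReal.top_div, ENNReal.top_rpow_of_pos (hp z)] at hz
      · rw [ENNReal.toReal_rpow, hH, ENNReal.rpow_rpow_inv (hp z).ne', ENNReal.toReal_div,
          ENNReal.toReal_ofReal ht.le]
    obtain ⟨hx1, hx2⟩ := hfin x hx.2.2
    obtain ⟨hy1, hy2⟩ := hfin y hy.2.2
    obtain ⟨n, hn1, hn2⟩ := exists_mem_Ico_zpow hd (one_lt_two (α := ℝ))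
    -- The index `k` governs distances in `[2 ^ (-k - 1), 2 ^ (-k))`, so a distance in `[2 ^ n, 2 ^
    -- (n + 1))` belongs to `k = -n - 1`.
    have h1 := hgrad (-n - 1) x y hx.1 hy.1 (by simpa using hn1)
      (by rw [show -(-n - 1) = n + 1 by ring]; exact hn2)
    lift u x to ℝ using hx.2.1 with a ha
    lift u y to ℝ using hy.2.1 with b hb
    rw [← EReal.coe_sub, EReal.abs_def] at h1
    have h2 : ENNReal.ofReal |a - b| ≤ ENNReal.ofReal (dist x y ^ s x * (⨆ k, g k x).toReal +
        dist x y ^ s y * (⨆ k, g k y).toReal) := by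
      rw [ENNReal.ofReal_add (by positivity) (by positivity), ENNReal.ofReal_mul (by positivity),
        ENNReal.ofReal_mul (by positivity), ENNReal.ofReal_toReal hx1, ENNReal.ofReal_toReal hy1]
      refine h1.trans ?_
      gcongr
      · exact le_iSup (fun k => g k x) _
      · exact le_iSup (fun k => g k y) _
    rw [ENNReal.ofReal_le_ofReal_iff (by positivity)] at h2
    rw [hx2, hy2, EReal.toReal_coe, EReal.toReal_coe, ← sub_div, abs_div, abs_of_pos ht]
    calc |a - b| / t ≤ (dist x y ^ s x * (⨆ k, g k x).toReal +
        dist x y ^ s y * (⨆ k, g k y).toReal) / t := by gcongr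
      _ = _ := by ring

end Norms

/-! ### Pointwise Sobolev, Moser–Trudinger and Morrey estimates. -/

section Inequalities

variable {X : Type*} [MetricSpace X] [MeasurableSpace X] {A b δ : ℝ} {Q p s : X → ℝ}

lemma HasGradientPower.ae_notMem {μ : Measure X} {N : Set X} {H : X → ℝ≥0∞} {w : X → ℝ}
    (h : HasGradientPower μ p s N H w) : ∀ᵐ x ∂μ, x ∉ N := by
  rw [ae_iff]; simpa using h.null

lemma HasGradientPower.integrable {μ : Measure X} {N : Set X} {H : X → ℝ≥0∞} {w : X → ℝ}
    (h : HasGradientPower μ p s N H w) : Integrable (fun x => (H x).toReal) μ :=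
  integrable_toReal_of_lintegral_ne_top h.measurable.aemeasurable
    (h.lintegral_le.trans_lt (by simp)).ne

lemma HasGradientPower.integral_le {μ : Measure X} {N : Set X} {H : X → ℝ≥0∞} {w : X → ℝ}
    (h : HasGradientPower μ p s N H w) : ∫ x, (H x).toReal ∂μ ≤ 2 := by
  have hfin := (h.lintegral_le.trans_lt (by simp : (2 : ℝ≥0∞) < ∞)).ne
  rw [integral_toReal h.measurable.aemeasurable (ae_lt_top h.measurable hfin)]
  have := ENNReal.toReal_mono (by simp) h.lintegral_le
  simpa using this

/-- The oscillation bound is read at a level `k` of `x` with `2 ^ k` at most a multiple of `1 + H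
x`. The base point `z` lies in the lowest level, so `H z` is bounded; the inhomogeneous inequality
uses this to control the value at `z`. -/
lemma exists_sobolev_pointwise [Nonempty X]
    (hA : SlowExponents A (fun x => (p x)⁻¹) s (fun x => (Q x)⁻¹)) {D : ℝ}
    (hD : ∀ x y : X, dist x y ≤ D) (hb : 0 < b) (hb1 : b ≤ 1) (hδ : 0 < δ) {β₀ : ℝ} (h0 : 0 < β₀)
    (hβ : ∀ x, β₀ ≤ (p x)⁻¹ - s x * (Q x)⁻¹) :
    ∃ C : ℝ, 1 ≤ C ∧ ∀ μ : Measure X, LowerMeasureBound μ b δ Q →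
      ∀ (N : Set X) (H : X → ℝ≥0∞) (w : X → ℝ), HasGradientPower μ p s N H w →
      ∃ z ∉ N, (H z).toReal ≤ C ∧ ∀ x ∉ N,
        |w x - w z| ≤ C * (1 + (H x).toReal) ^ ((p x)⁻¹ - s x * (Q x)⁻¹) := by
  obtain ⟨K₀, hK₀, k₀, h₁⟩ := exists_isLevelFamily hA hb hb1 hδ
  obtain ⟨C, hC, h₂⟩ := hA.exists_osc_subcritical hD hK₀ k₀ h0 hβ
  set B : ℝ := 2 ^ (k₀ + 1) with hB
  have hB1 : 1 ≤ B := one_le_pow₀ one_le_two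
  refine ⟨max (max 1 (2 ^ k₀)) (C * B ^ A), (le_max_left _ _).trans (le_max_left _ _), ?_⟩
  intro μ hμ N H w hw
  have hE := h₁ μ hμ N H w hw
  obtain ⟨z, hz, -⟩ := hE.near k₀ le_rfl (Classical.arbitrary X)
  refine ⟨z, hz.1, ?_, fun x hx => ?_⟩
  · have h3 := ENNReal.toReal_mono (by simp) hz.2
    simp only [ENNReal.toReal_pow, ENNReal.toReal_ofNat] at h3
    exact h3.trans ((le_max_right _ _).trans (le_max_left _ _))
  · obtain ⟨k, hk, hxk, hk2⟩ := exists_mem_levelSet hx (hw.ne_top x hx) k₀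
    have hβx : 0 ≤ (p x)⁻¹ - s x * (Q x)⁻¹ := h0.le.trans (hβ x)
    calc |w x - w z| ≤ C * (2 : ℝ) ^ (k * ((p x)⁻¹ - s x * (Q x)⁻¹)) := h₂ _ w hE k x z hk hxk hz
      _ = C * ((2 : ℝ) ^ k) ^ ((p x)⁻¹ - s x * (Q x)⁻¹) := by
        rw [← Real.rpow_natCast, ← Real.rpow_mul two_pos.le]
      _ ≤ C * (B * (1 + (H x).toReal)) ^ ((p x)⁻¹ - s x * (Q x)⁻¹) := by gcongr
      _ = C * B ^ ((p x)⁻¹ - s x * (Q x)⁻¹) * (1 + (H x).toReal) ^ ((p x)⁻¹ - s x * (Q x)⁻¹) := by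
        rw [Real.mul_rpow (by positivity) (by positivity), mul_assoc]
      _ ≤ C * B ^ A * (1 + (H x).toReal) ^ ((p x)⁻¹ - s x * (Q x)⁻¹) := by
        gcongr
        exact hA.beta_le x
      _ ≤ _ := by gcongr; exact le_max_right _ _

lemma exists_moser_pointwise [Nonempty X]
    (hA : SlowExponents A (fun x => (p x)⁻¹) s (fun x => (Q x)⁻¹)) {D : ℝ}
    (hD : ∀ x y : X, dist x y ≤ D) (hb : 0 < b) (hb1 : b ≤ 1) (hδ : 0 < δ)
    (hβ : ∀ x, (p x)⁻¹ - s x * (Q x)⁻¹ = 0) :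
    ∃ C : ℝ, 0 < C ∧ ∀ μ : Measure X, LowerMeasureBound μ b δ Q →
      ∀ (N : Set X) (H : X → ℝ≥0∞) (w : X → ℝ), HasGradientPower μ p s N H w →
      ∃ z, ∀ x ∉ N, |w x - w z| ≤ C * (1 + Real.log (1 + (H x).toReal)) := by
  obtain ⟨K₀, hK₀, k₀, h₁⟩ := exists_isLevelFamily hA hb hb1 hδ
  obtain ⟨C, hC, h₂⟩ := hA.exists_osc_critical hD hK₀ k₀ hβ
  have hl2 : 0 < Real.log 2 := Real.log_pos one_lt_two
  refine ⟨C * (k₀ + 2 + (Real.log 2)⁻¹), by positivity, ?_⟩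
  intro μ hμ N H w hw
  have hE := h₁ μ hμ N H w hw
  obtain ⟨z, hz, -⟩ := hE.near k₀ le_rfl (Classical.arbitrary X)
  refine ⟨z, fun x hx => ?_⟩
  obtain ⟨k, hk, hxk, hk2⟩ := exists_mem_levelSet hx (hw.ne_top x hx) k₀
  have hH : 0 ≤ (H x).toReal := ENNReal.toReal_nonneg
  have hlog : 0 ≤ Real.log (1 + (H x).toReal) := Real.log_nonneg (by linarith)
  have h3 := Real.log_le_log (by positivity) hk2
  rw [Real.log_mul (by positivity) (by positivity), Real.log_pow, Real.log_pow] at h3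
  have h4 : (k : ℝ) ≤ k₀ + 1 + (Real.log 2)⁻¹ * Real.log (1 + (H x).toReal) := by
    rw [← mul_le_mul_iff_left₀ hl2]
    calc _ ≤ _ := h3
      _ = _ := by push_cast; field_simp
  refine (h₂ _ w hE k x z hk hxk hz).trans ?_
  rw [mul_assoc]
  gcongr
  have h5 : 0 ≤ ((k₀ : ℝ) + 2) * Real.log (1 + (H x).toReal) := by positivity
  have h6 := inv_pos.2 hl2
  linarith

lemma exists_morrey_pointwise [Nonempty X]
    (hA : SlowExponents A (fun x => (p x)⁻¹) s (fun x => (Q x)⁻¹)) {D : ℝ}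
    (hD : ∀ x y : X, dist x y ≤ D) (hb : 0 < b) (hb1 : b ≤ 1) (hδ : 0 < δ) {β₀ : ℝ} (h0 : 0 < β₀)
    (hβ : ∀ x, (p x)⁻¹ - s x * (Q x)⁻¹ ≤ -β₀) :
    ∃ C : ℝ, 0 < C ∧ ∀ μ : Measure X, LowerMeasureBound μ b δ Q →
      ∀ (N : Set X) (H : X → ℝ≥0∞) (w : X → ℝ), HasGradientPower μ p s N H w →
      (∃ z, ∀ x ∉ N, |w x - w z| ≤ C) ∧
      ∀ x ∉ N, ∀ y ∉ N, |w x - w y| ≤ C * dist x y ^ (s x - Q x / p x) := by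
  obtain ⟨K₀, hK₀, k₀, h₁⟩ := exists_isLevelFamily hA hb hb1 hδ
  obtain ⟨C, hC, h₂⟩ := hA.exists_osc_supercritical hD hK₀ k₀ h0 hβ
  obtain ⟨C', hC', h₃⟩ := hA.exists_holder hD hK₀ k₀ h0 hβ
  refine ⟨max C C', lt_max_of_lt_left hC, fun μ hμ N H w hw => ?_⟩
  have hE := h₁ μ hμ N H w hw
  obtain ⟨z, hz, -⟩ := hE.near k₀ le_rfl (Classical.arbitrary X)
  refine ⟨⟨z, fun x hx => ?_⟩, fun x hx y hy => ?_⟩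
  · obtain ⟨k, hk, hxk, -⟩ := exists_mem_levelSet hx (hw.ne_top x hx) k₀
    exact (h₂ _ w hE k x z hk hxk hz).trans (le_max_left _ _)
  · obtain ⟨k, -, hxk, -⟩ := exists_mem_levelSet hx (hw.ne_top x hx) k₀
    obtain ⟨l, -, hyl, -⟩ := exists_mem_levelSet hy (hw.ne_top y hy) k₀
    -- The Hölder constant does not depend on the level, so any common level of `x` and `y` will do.
    have := h₃ _ w hE (max k l) x y (hE.mono (le_max_left _ _) hxk) (hE.mono (le_max_right _ _) hyl)
    rw [show (p x)⁻¹ / (Q x)⁻¹ = Q x / p x by rw [inv_div_inv]] at this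
    exact this.trans (by gcongr; exact le_max_right _ _)

end Inequalities

/-! ### Integrating the pointwise estimates and extending Hölder functions. -/

section Integration

variable {X : Type*} [MeasurableSpace X] {μ : Measure X}

lemma abs_sub_average_le [IsFiniteMeasure μ] [NeZero μ] {w F : X → ℝ} {a : ℝ}
    (hw : Integrable w μ) (hF : Integrable F μ) (h : ∀ᵐ x ∂μ, |w x - a| ≤ F x) :
    |a - ⨍ x, w x ∂μ| ≤ ⨍ x, F x ∂μ := by
  have h1 : ⨍ x, w x ∂μ - a = ⨍ x, (w x - a) ∂μ := by
    conv_lhs => rw [← average_const μ a]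
    simp only [average]
    rw [← integral_sub hw.to_average (integrable_const a)]
  rw [abs_sub_comm, h1, average_eq, average_eq, smul_eq_mul, smul_eq_mul, abs_mul,
    abs_of_nonneg (by positivity)]
  gcongr
  rw [← Real.norm_eq_abs]
  exact norm_integral_le_of_norm_le hF h

/-- As `β γ = 1`, the `γ`-th power of the majorant is essentially `1 + H`, of integral at most `M =
μ(X) + 2`. Dividing by `M ^ A` normalises it, since `A γ ≥ 1`. This is where the total mass enters
the Sobolev constant. -/
lemma lpNorm_le_of_pointwise {γ β : X → ℝ} {A C T : ℝ} (hC : 0 < C) (hT : 0 < T)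
    (hγ : ∀ x, 0 < γ x) (hβ : ∀ x, β x = (γ x)⁻¹) (hβA : ∀ x, β x ≤ A) {H : X → ℝ≥0∞}
    (hH2 : ∫⁻ x, H x ∂μ ≤ 2) (hμ : μ univ ≠ ∞) {f : X → ℝ≥0∞}
    (hf : ∀ᵐ x ∂μ, f x ≤ ENNReal.ofReal (T * (C * (1 + (H x).toReal) ^ β x))) :
    lpNorm μ γ f ≤ ENNReal.ofReal (C * ((μ univ).toReal + 2) ^ A * T) := by
  set M := (μ univ).toReal + 2 with hM
  have hM0 : 0 ≤ (μ univ).toReal := ENNReal.toReal_nonneg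
  have hM1 : 1 ≤ M := by linarith
  have hMpos : 0 < M := by linarith
  have hMtop : ENNReal.ofReal M = μ univ + 2 := by
    rw [hM, ENNReal.ofReal_add hM0 (by norm_num), ENNReal.ofReal_toReal hμ]; simp
  refine sInf_le ⟨ENNReal.ofReal_pos.2 (by positivity), ENNReal.ofReal_lt_top, ?_⟩
  calc modular μ γ (fun x => f x / ENNReal.ofReal (C * M ^ A * T))
      ≤ ∫⁻ x, (1 + H x) * (ENNReal.ofReal M)⁻¹ ∂μ := by
        refine lintegral_mono_ae (hf.mono fun x hx => ?_)
        have hh : 0 ≤ (H x).toReal := ENNReal.toReal_nonneg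
        have e1 : f x / ENNReal.ofReal (C * M ^ A * T) ≤
            ENNReal.ofReal ((1 + (H x).toReal) ^ β x / M ^ A) := by
          refine (ENNReal.div_le_div_right hx _).trans_eq ?_
          rw [← ENNReal.ofReal_div_of_pos (by positivity)]
          congr 1
          field_simp
        have hβγ : β x * γ x = 1 := by rw [hβ, inv_mul_cancel₀ (hγ x).ne']
        calc (f x / ENNReal.ofReal (C * M ^ A * T)) ^ γ x
            ≤ (ENNReal.ofReal ((1 + (H x).toReal) ^ β x / M ^ A)) ^ γ x :=
              ENNReal.rpow_le_rpow e1 (hγ x).le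
          _ = ENNReal.ofReal ((1 + (H x).toReal) / M ^ (A * γ x)) := by
              rw [ENNReal.ofReal_rpow_of_nonneg (by positivity) (hγ x).le,
                Real.div_rpow (by positivity) (by positivity), ← Real.rpow_mul (by positivity),
                ← Real.rpow_mul hMpos.le, hβγ, Real.rpow_one]
          _ ≤ ENNReal.ofReal ((1 + (H x).toReal) / M) := by
              apply ENNReal.ofReal_le_ofReal
              gcongr
              apply Real.self_le_rpow_of_one_le hM1
              rw [← hβγ]
              have := hγ x
              gcongr
              exact hβA x
          _ ≤ (1 + H x) * (ENNReal.ofReal M)⁻¹ := by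
              rw [ENNReal.ofReal_div_of_pos hMpos, ENNReal.ofReal_add zero_le_one hh,
                ENNReal.ofReal_one, div_eq_mul_inv]
              gcongr
              exact ENNReal.ofReal_toReal_le
    _ = (∫⁻ x, (1 + H x) ∂μ) * (ENNReal.ofReal M)⁻¹ :=
        lintegral_mul_const' _ _ (ENNReal.inv_ne_top.2 (ENNReal.ofReal_pos.2 hMpos).ne')
    _ ≤ ENNReal.ofReal M * (ENNReal.ofReal M)⁻¹ := by
        gcongr
        rw [lintegral_add_left measurable_const, hMtop, lintegral_one]
        gcongr
    _ ≤ 1 := ENNReal.mul_inv_le_one _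

/-- The norm is an infimum that may vanish or not be attained, so estimates are proved for each real
`t` above it. -/
lemma le_mul_of_forall_lt {a n : ℝ≥0∞} {C : ℝ} (hC : 0 < C)
    (h : ∀ t : ℝ, 0 < t → n < ENNReal.ofReal t → a ≤ ENNReal.ofReal (C * t)) :
    a ≤ ENNReal.ofReal C * n := by
  rcases eq_or_ne n ∞ with rfl | hn
  · rw [ENNReal.mul_top (ENNReal.ofReal_pos.2 hC).ne']; exact le_top
  refine ENNReal.le_of_forall_pos_le_add fun ε hε _ => ?_
  have hε' : (0 : ℝ) < ε := hε
  have h1 : n < ENNReal.ofReal (n.toReal + ε / C) := by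
    conv_lhs => rw [← ENNReal.ofReal_toReal hn]
    rw [ENNReal.ofReal_lt_ofReal_iff (by positivity)]
    have : 0 < ε / C := by positivity
    linarith
  refine (h _ (by positivity) h1).trans_eq ?_
  rw [mul_add, mul_div_cancel₀ _ hC.ne', ENNReal.ofReal_add (by positivity) hε'.le,
    ENNReal.ofReal_mul hC.le, ENNReal.ofReal_toReal hn, ENNReal.ofReal_coe_nnreal]

/-- A function which is Hölder continuous, with a variable exponent, on a dense set extends to the
whole space. -/
lemma exists_continuous_extension {Y : Type*} [MetricSpace Y] {S : Set Y} (hS : Dense S)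
    {U α : Y → ℝ} (hα : Continuous α) {α₀ L : ℝ} (hα₀ : 0 < α₀) (hα' : ∀ x, α₀ ≤ α x)
    (h : ∀ x ∈ S, ∀ y ∈ S, |U x - U y| ≤ L * dist x y ^ α x) :
    ∃ v : Y → ℝ, Continuous v ∧ (∀ x ∈ S, v x = U x) ∧
      ∀ x y, |v x - v y| ≤ L * dist x y ^ α x := by
  have hUC : UniformContinuous (fun x : S => U x) := by
    rw [Metric.uniformContinuous_iff]
    intro ε hε
    have ht : Filter.Tendsto (fun r : ℝ => |L| * r ^ α₀) (nhds 0) (nhds (|L| * 0 ^ α₀)) :=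
      ((Real.continuous_rpow_const hα₀.le).tendsto 0).const_mul _
    rw [Real.zero_rpow hα₀.ne', mul_zero] at ht
    obtain ⟨η, hη, hη'⟩ := Metric.eventually_nhds_iff.1 (ht.eventually_lt_const hε)
    refine ⟨min η 1, by positivity, fun a b hab => ?_⟩
    have h1 : dist (a : Y) b < η := lt_of_lt_of_le hab (min_le_left _ _)
    have h2 : dist (a : Y) b ≤ 1 := (lt_of_lt_of_le hab (min_le_right _ _)).le
    rw [Real.dist_eq]
    calc |U a - U b| ≤ L * dist (a : Y) b ^ α a := h a a.2 b b.2
      _ ≤ |L| * dist (a : Y) b ^ α a := by gcongr; exact le_abs_self L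
      _ ≤ |L| * dist (a : Y) b ^ α₀ := by
        gcongr ?_ * ?_
        exact Real.rpow_le_rpow_of_exponent_ge' dist_nonneg h2 hα₀.le (hα' a)
      _ < ε := hη' (by rw [Real.dist_eq, sub_zero, abs_of_nonneg dist_nonneg]; exact h1)
  have hv := uniformContinuous_uniformly_extend (isUniformInducing_val S) hS.denseRange_val hUC
  have hvS := fun x hx =>
    uniformly_extend_of_ind (isUniformInducing_val S) hS.denseRange_val hUC ⟨x, hx⟩
  refine ⟨_, hv.continuous, hvS, ?_⟩
  generalize (((isUniformInducing_val S).isDenseInducing hS.denseRange_val).extend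
    (fun x : S => U x)) = v at *
  -- The estimate passes from the dense set `S ×ˢ S` to all pairs by closedness. Positivity of `α`
  -- keeps the power continuous on the diagonal.
  have hcl : IsClosed {z : Y × Y | |v z.1 - v z.2| ≤ L * dist z.1 z.2 ^ α z.1} := by
    have hvc := hv.continuous
    refine isClosed_le (by fun_prop) (continuous_const.mul (Continuous.rpow (by fun_prop)
      (by fun_prop) fun z => Or.inr (hα₀.trans_le (hα' _))))
  intro x y
  have hsub : S ×ˢ S ⊆ {z : Y × Y | |v z.1 - v z.2| ≤ L * dist z.1 z.2 ^ α z.1} := by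
    intro z hz
    have h1 := h z.1 hz.1 z.2 hz.2
    rw [← hvS z.1 hz.1, ← hvS z.2 hz.2] at h1
    exact h1
  have := closure_minimal hsub hcl
  rw [(hS.prod hS).closure_eq] at this
  exact this (mem_univ (x, y))

end Integration

/-! ### The embedding theorems. -/

section Embedding

variable {X : Type*} [MetricSpace X] [MeasurableSpace X] {μ : Measure X} {b δ : ℝ} {Q p s : X → ℝ}
  {q : X → ℝ≥0∞} {A : Scale} {u : X → EReal} {g : ℤ → X → ℝ≥0∞}

lemma Setting.mixedNorm_lt_top (hS : Setting μ b δ Q p s) (hq : AdmissibleExponent A μ p q)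
    (hgm : MemMixed A μ p q g) : mixedNorm A μ p q g < ∞ := by
  obtain ⟨B, hB, hp⟩ := hS.p_log.exists_bounds hS.metricMeasure
  have hB0 : 0 < B := zero_lt_one.trans_le hB
  exact HajlaszEmbedding.mixedNorm_lt_top (inv_pos.2 hB0)
    (fun x => inv_le_of_inv_le₀ (hS.p_log.bdd.pos x) (hp x).2) hq hgm

lemma Setting.exists_hasGradientPower (hS : Setting μ b δ Q p s) (hq : AdmissibleExponent A μ p q)
    (hu : MemHom A μ s p q u) (hg : IsVectorGradient μ s u g) {t : ℝ} (ht : 0 < t)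
    (h : mixedNorm A μ p q g < ENNReal.ofReal t) :
    ∃ (N : Set X) (H : X → ℝ≥0∞), HasGradientPower μ p s N H (fun x => (u x).toReal / t) ∧
      ∀ x ∉ N, u x ≠ ⊤ ∧ u x ≠ ⊥ := by
  have hp := hS.p_log.bdd.pos
  have hpm := hS.p_log.bdd.measurable
  obtain ⟨H, N, hHm, hH, hN, hfin, hw⟩ := exists_hajlasz_gradient hp hpm hu.ae_finite hg ht
    (modular_iSup_le_one hp hpm hq hg.1 ENNReal.ofReal_ne_top h)
  exact ⟨N, H, ⟨hN, hHm, hH.trans (by norm_num), fun x hx => (hfin x hx).2, hw⟩,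
    fun x hx => (hfin x hx).1⟩

/-- Adding `(|u| / t) ^ p` to `H` keeps the integral at most `2` and makes `H` control the function
itself, so that `u / t` is bounded wherever `H` is. -/
lemma Setting.exists_hasGradientPower_of_memInhom (hS : Setting μ b δ Q p s)
    (hq : AdmissibleExponent A μ p q) (hu : MemInhom A μ s p q u) (hg : IsVectorGradient μ s u g)
    {t : ℝ} (ht : 0 < t) (h : mixedNorm A μ p q g < ENNReal.ofReal t)
    (h' : lpNorm μ p (fun x => (u x).abs) < ENNReal.ofReal t) :
    ∃ (N : Set X) (H : X → ℝ≥0∞), HasGradientPower μ p s N H (fun x => (u x).toReal / t) ∧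
      (∀ x ∉ N, u x ≠ ⊤ ∧ u x ≠ ⊥) ∧ ∀ x ∉ N, |(u x).toReal / t| ≤ (H x).toReal ^ (p x)⁻¹ := by
  have hp := hS.p_log.bdd.pos
  have hpm := hS.p_log.bdd.measurable
  obtain ⟨H, N, hHm, hH, hN, hfin, hw⟩ := exists_hajlasz_gradient hp hpm hu.memHom.ae_finite hg ht
    (modular_iSup_le_one hp hpm hq hg.1 ENNReal.ofReal_ne_top h)
  obtain ⟨t', ⟨-, -, h1⟩, htt⟩ := sInf_lt_iff.1 h'
  set F : X → ℝ≥0∞ := fun x => ((u x).abs / ENNReal.ofReal t) ^ p x with hF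
  have hFm : Measurable F := (hu.memLp.1.div_const _).pow hpm
  have hF1 : ∫⁻ x, F x ∂μ ≤ 1 :=
    (modular_mono hp (.of_forall fun x => by gcongr)).trans h1
  have hFx : ∀ x, u x ≠ ⊤ ∧ u x ≠ ⊥ → F x ≠ ∞ ∧
      (F x).toReal ^ (p x)⁻¹ = |(u x).toReal / t| := by
    intro x hx
    simp only [hF]
    lift u x to ℝ using hx with a
    rw [EReal.abs_def, ← ENNReal.ofReal_div_of_pos ht, EReal.toReal_coe, abs_div, abs_of_pos ht]
    refine ⟨ENNReal.rpow_ne_top_of_nonneg (hp x).le ENNReal.ofReal_ne_top, ?_⟩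
    rw [ENNReal.toReal_rpow, ENNReal.rpow_rpow_inv (hp x).ne', ENNReal.toReal_ofReal (by positivity)]
  have hsum : ∀ x ∉ N, (H x + F x).toReal = (H x).toReal + (F x).toReal := fun x hx =>
    ENNReal.toReal_add (hfin x hx).2 (hFx x (hfin x hx).1).1
  have hmono : ∀ x ∉ N, (H x).toReal ^ (p x)⁻¹ ≤ (H x + F x).toReal ^ (p x)⁻¹ := by
    intro x hx
    have := hp x
    rw [hsum x hx]
    gcongr
    exact le_add_of_nonneg_right ENNReal.toReal_nonneg
  refine ⟨N, fun x => H x + F x, ⟨hN, hHm.add hFm, ?_, fun x hx => ?_, fun x hx y hy => ?_⟩,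
    fun x hx => (hfin x hx).1, fun x hx => ?_⟩
  · rw [lintegral_add_left hHm]
    exact (add_le_add hH hF1).trans (by norm_num)
  · exact ENNReal.add_ne_top.2 ⟨(hfin x hx).2, (hFx x (hfin x hx).1).1⟩
  · refine (hw x hx y hy).trans ?_
    exact add_le_add (mul_le_mul_of_nonneg_left (hmono x hx) (by positivity))
      (mul_le_mul_of_nonneg_left (hmono y hy) (by positivity))
  · have := hp x
    rw [← (hFx x (hfin x hx).1).2, hsum x hx]
    gcongr
    exact le_add_of_nonneg_left ENNReal.toReal_nonneg

lemma MuchLess.exists_forall {f f' : X → ℝ} (h : MuchLess μ f f') (hμ : IsMetricMeasure μ)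
    (hf : Continuous f) (hf' : Continuous f') : ∃ a : ℝ, 0 < a ∧ ∀ x, a ≤ f' x - f x := by
  obtain ⟨a, ha, h1⟩ := h
  exact ⟨a, ha, hμ.le_of_ae_le continuous_const (hf'.sub hf) h1⟩

lemma abs_coe_sub_of_finite {a : EReal} (ha : a ≠ ⊤ ∧ a ≠ ⊥) (c : ℝ) :
    (a - (c : EReal)).abs = ENNReal.ofReal |a.toReal - c| := by
  lift a to ℝ using ha
  rw [← EReal.coe_sub, EReal.abs_def, EReal.toReal_coe]

variable [Nonempty X]

theorem sobolev_embedding (hX : Bornology.IsBounded (univ : Set X)) (hb : 0 < b) (hb1 : b ≤ 1)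
    (hδ : 0 < δ) (m : ℝ≥0∞) : ∃ C : ℝ, 0 < C ∧ ∀ μ : Measure X,
      Setting μ b δ Q p s → μ univ = m → MuchLess μ (fun x => s x * p x) Q →
      ∀ (A : Scale) (q : X → ℝ≥0∞), AdmissibleExponent A μ p q →
        (∀ (u : X → EReal) (g : ℤ → X → ℝ≥0∞), MemHom A μ s p q u →
          IsVectorGradient μ s u g → MemMixed A μ p q g →
          ⨅ c : ℝ, lpNorm μ (fun x => Q x * p x / (Q x - s x * p x))
              (fun x => (u x - (c : EReal)).abs)
            ≤ ENNReal.ofReal C * mixedNorm A μ p q g) ∧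
        (∀ (u : X → EReal) (g : ℤ → X → ℝ≥0∞), MemInhom A μ s p q u →
          IsVectorGradient μ s u g → MemMixed A μ p q g →
          lpNorm μ (fun x => Q x * p x / (Q x - s x * p x)) (fun x => (u x).abs)
            ≤ ENNReal.ofReal C * (lpNorm μ p (fun x => (u x).abs) + mixedNorm A μ p q g)) := by
  -- Constants must precede `μ`. One admissible measure suffices to extract the pointwise bounds on
  -- the exponents, which then serve every other; if there is none, the claim is vacuous.
  by_cases hex : ∃ μ : Measure X, Setting μ b δ Q p s ∧ MuchLess μ (fun x => s x * p x) Q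
  swap
  · exact ⟨1, one_pos, fun μ h1 _ h2 => absurd ⟨μ, h1, h2⟩ hex⟩
  obtain ⟨μ₀, hS₀, hL₀⟩ := hex
  obtain ⟨A₀, hA⟩ := hS₀.exists_slowExponents
  obtain ⟨a, ha, hL⟩ := hL₀.exists_forall hS₀.metricMeasure
    (hS₀.s_log.continuous.mul hS₀.p_log.continuous) hS₀.Q_log.continuous
  obtain ⟨D, hD⟩ := Metric.isBounded_iff.1 hX
  have hp := hS₀.p_log.bdd.pos
  have hQ := hS₀.Q_log.bdd.pos
  have hA0 := hA.pos
  have hβ : ∀ x, a * (A₀⁻¹ * A₀⁻¹) ≤ (p x)⁻¹ - s x * (Q x)⁻¹ := by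
    intro x
    have h1 : (p x)⁻¹ - s x * (Q x)⁻¹ = (Q x - s x * p x) * ((p x)⁻¹ * (Q x)⁻¹) := by
      have := (hp x).ne'
      have := (hQ x).ne'
      field_simp
    rw [h1]
    have h2 := hL x
    have h3 := (hA.P_mem x).1
    have h4 := (hA.R_mem x).1
    have h5 := (hA.P_pos x).le
    gcongr
    exact ha.le.trans h2
  have hγ : ∀ x, 0 < Q x * p x / (Q x - s x * p x) := fun x =>
    div_pos (mul_pos (hQ x) (hp x)) (ha.trans_le (hL x))
  have hβγ : ∀ x, (p x)⁻¹ - s x * (Q x)⁻¹ = (Q x * p x / (Q x - s x * p x))⁻¹ := by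
    intro x
    have := (hp x).ne'
    have := (hQ x).ne'
    rw [inv_div]
    field_simp
  obtain ⟨C, hC1, hC⟩ := exists_sobolev_pointwise hA (fun x y => hD (mem_univ x) (mem_univ y)) hb
    hb1 hδ (by positivity) hβ
  have hC0 : 0 < C := zero_lt_one.trans_le hC1
  have hm : 0 ≤ m.toReal := ENNReal.toReal_nonneg
  have hCA : 0 < C ^ A₀ := by positivity
  have hK : 0 < (C + C ^ A₀) * (m.toReal + 2) ^ A₀ := by positivity
  -- `C` accounts for the oscillation around `z`, and `C ^ A₀` for the value at `z` in the
  -- inhomogeneous case.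
  refine ⟨(C + C ^ A₀) * (m.toReal + 2) ^ A₀, hK, ?_⟩
  rintro μ hS rfl - A q hq
  have hμ : μ univ ≠ ∞ := (hS.metricMeasure.univ_lt_top hX).ne
  constructor
  · intro u g hu hg hgm
    refine le_mul_of_forall_lt hK fun t ht hlt => ?_
    obtain ⟨N, H, hw, hfin⟩ := hS.exists_hasGradientPower hq hu hg ht hlt
    obtain ⟨z, hz, -, hpt⟩ := hC μ hS.lower N H _ hw
    refine iInf_le_of_le (u z).toReal (lpNorm_le_of_pointwise (by positivity) ht hγ hβγ
      hA.beta_le hw.lintegral_le hμ ?_)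
    filter_upwards [hw.ae_notMem] with x hx
    rw [abs_coe_sub_of_finite (hfin x hx)]
    apply ENNReal.ofReal_le_ofReal
    have h1 := hpt x hx
    rw [← sub_div, abs_div, abs_of_pos ht, div_le_iff₀ ht] at h1
    have h2 : 0 ≤ (1 + (H x).toReal) ^ ((p x)⁻¹ - s x * (Q x)⁻¹) := by positivity
    calc _ ≤ _ := h1
      _ = t * (C * (1 + (H x).toReal) ^ ((p x)⁻¹ - s x * (Q x)⁻¹)) := by ring
      _ ≤ _ := by gcongr; linarith
  · intro u g hu hg hgm
    refine le_mul_of_forall_lt hK fun t ht hlt => ?_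
    obtain ⟨N, H, hw, hfin, hwH⟩ := hS.exists_hasGradientPower_of_memInhom hq hu hg ht
      (lt_of_le_of_lt le_add_self hlt) (lt_of_le_of_lt le_self_add hlt)
    obtain ⟨z, hz, hzC, hpt⟩ := hC μ hS.lower N H _ hw
    refine lpNorm_le_of_pointwise (by positivity) ht hγ hβγ hA.beta_le hw.lintegral_le hμ ?_
    filter_upwards [hw.ae_notMem] with x hx
    have h0 := abs_coe_sub_of_finite (hfin x hx) 0
    rw [EReal.coe_zero, sub_zero, sub_zero] at h0
    rw [h0]
    apply ENNReal.ofReal_le_ofReal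
    have h1 := hpt x hx
    have h2 : 1 ≤ (1 + (H x).toReal) ^ ((p x)⁻¹ - s x * (Q x)⁻¹) :=
      Real.one_le_rpow (le_add_of_nonneg_right ENNReal.toReal_nonneg)
        (le_trans (by positivity) (hβ x))
    have h3 : |(u z).toReal / t| ≤ C ^ A₀ := by
      refine (hwH z hz).trans ?_
      calc (H z).toReal ^ (p z)⁻¹ ≤ C ^ (p z)⁻¹ := by
            gcongr; exact (hA.P_pos z).le
        _ ≤ C ^ A₀ := by
            gcongr
            exact (hA.P_mem z).2
    have h4 : |(u x).toReal / t| ≤ (C + C ^ A₀) *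
        (1 + (H x).toReal) ^ ((p x)⁻¹ - s x * (Q x)⁻¹) := by
      have h5 := abs_sub_abs_le_abs_sub ((u x).toReal / t) ((u z).toReal / t)
      have h6 : C ^ A₀ * 1 ≤ C ^ A₀ * (1 + (H x).toReal) ^ ((p x)⁻¹ - s x * (Q x)⁻¹) := by
        gcongr
      linarith
    rw [abs_div, abs_of_pos ht, div_le_iff₀ ht] at h4
    linarith

theorem moser_trudinger (hX : Bornology.IsBounded (univ : Set X)) (hb : 0 < b) (hb1 : b ≤ 1)
    (hδ : 0 < δ) : ∃ C₁ C₂ : ℝ, 0 < C₁ ∧ 0 < C₂ ∧ ∀ μ : Measure X,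
      Setting μ b δ Q p s → (∀ x, s x * p x = Q x) →
      ∀ (A : Scale) (q : X → ℝ≥0∞), AdmissibleExponent A μ p q →
        ∀ (u : X → EReal) (g : ℤ → X → ℝ≥0∞), MemHom A μ s p q u →
          IsVectorGradient μ s u g → MemMixed A μ p q g → 0 < mixedNorm A μ p q g →
          Integrable (fun x => (u x).toReal) μ ∧
          ⨍⁻ x, ENNReal.ofReal (Real.exp (C₁ * (|(u x).toReal - mean μ u|
              / (mixedNorm A μ p q g).toReal))) ∂μ ≤ ENNReal.ofReal C₂ := by
  by_cases hex : ∃ μ : Measure X, Setting μ b δ Q p s ∧ ∀ x, s x * p x = Q x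
  swap
  · exact ⟨1, 1, one_pos, one_pos, fun μ h1 h2 => absurd ⟨μ, h1, h2⟩ hex⟩
  obtain ⟨μ₀, hS₀, hsp⟩ := hex
  obtain ⟨A₀, hA⟩ := hS₀.exists_slowExponents
  obtain ⟨D, hD⟩ := Metric.isBounded_iff.1 hX
  have hp := hS₀.p_log.bdd.pos
  have hQ := hS₀.Q_log.bdd.pos
  have hβ : ∀ x, (p x)⁻¹ - s x * (Q x)⁻¹ = 0 := by
    intro x
    have := (hp x).ne'
    have := (hQ x).ne'
    field_simp
    linarith [hsp x]
  obtain ⟨C, hC0, hC⟩ := exists_moser_pointwise hA (fun x y => hD (mem_univ x) (mem_univ y)) hb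
    hb1 hδ hβ
  have x₀ : X := Classical.arbitrary X
  -- The lower bound on a single ball of radius `δ` gives `1 / μ(X) ≤ κ`, so the constants do not
  -- involve the total mass.
  set κ : ℝ := (b * δ ^ Q x₀)⁻¹ with hκ
  have hκ0 : 0 < κ := by positivity
  refine ⟨C⁻¹ / 2, Real.exp (2 + 2 * κ) * (1 + 2 * κ), by positivity, by positivity, ?_⟩
  intro μ hS _ A q hq u g hu hg hgm hpos
  have hμ : μ univ < ∞ := hS.metricMeasure.univ_lt_top hX
  have : IsFiniteMeasure μ := ⟨hμ⟩
  have hμκ : κ⁻¹ ≤ μ.real univ := by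
    rw [hκ, inv_inv, measureReal_def, ← ENNReal.ofReal_le_iff_le_toReal hμ.ne]
    exact (hS.lower x₀ δ hδ le_rfl).trans (measure_mono (subset_univ _))
  have hμr : 0 < μ.real univ := (inv_pos.2 hκ0).trans_le hμκ
  have hμκ' : (μ.real univ)⁻¹ ≤ κ := inv_le_of_inv_le₀ hκ0 hμκ
  have : NeZero μ := ⟨fun h => by simp [h] at hμr⟩
  have hfinite := hS.mixedNorm_lt_top hq hgm
  set n := (mixedNorm A μ p q g).toReal with hn
  have hn0 : 0 < n := ENNReal.toReal_pos hpos.ne' hfinite.ne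
  -- A strict upper bound for the norm is required, and `n > 0` makes `2 n` one. The factor `2` is
  -- compensated by the `1 / 2` in the exponential constant.
  have hlt : mixedNorm A μ p q g < ENNReal.ofReal (2 * n) := by
    rw [← ENNReal.ofReal_toReal hfinite.ne, ← hn, ENNReal.ofReal_lt_ofReal_iff (by positivity)]
    linarith
  have ht : 0 < 2 * n := by positivity
  obtain ⟨N, H, hw, hfin⟩ := hS.exists_hasGradientPower hq hu hg ht hlt
  obtain ⟨z, hpt⟩ := hC μ hS.lower N H _ hw
  set w : X → ℝ := fun x => (u x).toReal / (2 * n) with hwdef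
  have hH0 : ∀ x, 0 ≤ (H x).toReal := fun x => ENNReal.toReal_nonneg
  have hum : Measurable (fun x => (u x).toReal) := hu.measurable.ereal_toReal
  have hwm : Measurable w := hum.div_const _
  have hFint : Integrable (fun x => C * (1 + (H x).toReal)) μ :=
    ((integrable_const 1).add hw.integrable).const_mul C
  have hbd : ∀ᵐ x ∂μ, |w x - w z| ≤ C * (1 + (H x).toReal) := by
    filter_upwards [hw.ae_notMem] with x hx
    refine (hpt x hx).trans ?_
    gcongr
    have := Real.log_le_sub_one_of_pos (show 0 < 1 + (H x).toReal by linarith [hH0 x])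
    linarith
  have hwint : Integrable w μ := by
    have h1 : Integrable (fun x => w x - w z) μ :=
      hFint.mono' (hwm.sub_const _).aestronglyMeasurable hbd
    simpa only [Pi.add_def, sub_add_cancel] using h1.add (integrable_const (w z))
  have hint : Integrable (fun x => (u x).toReal) μ := by
    have := hwint.mul_const (2 * n)
    refine this.congr (.of_forall fun x => ?_)
    simp only [hwdef]
    field_simp
  refine ⟨hint, ?_⟩
  have hmean : ⨍ x, w x ∂μ = mean μ u / (2 * n) := integral_div _ _
  have havg : |w z - ⨍ x, w x ∂μ| ≤ C * (1 + 2 * κ) := by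
    refine (abs_sub_average_le hwint hFint hbd).trans ?_
    rw [average_eq, integral_const_mul, integral_add (integrable_const _) hw.integrable,
      integral_const, smul_eq_mul, smul_eq_mul, mul_one]
    calc (μ.real univ)⁻¹ * (C * (μ.real univ + ∫ x, (H x).toReal ∂μ))
        ≤ (μ.real univ)⁻¹ * (C * (μ.real univ + 2)) := by gcongr; exact hw.integral_le
      _ = C * (1 + 2 * (μ.real univ)⁻¹) := by field_simp
      _ ≤ _ := by gcongr
  have hexp : ∀ᵐ x ∂μ, ENNReal.ofReal (Real.exp (C⁻¹ / 2 * (|(u x).toReal - mean μ u| / n))) ≤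
      ENNReal.ofReal (Real.exp (2 + 2 * κ)) * (1 + H x) := by
    filter_upwards [hw.ae_notMem] with x hx
    have h1 : |(u x).toReal - mean μ u| / n = 2 * |w x - ⨍ x, w x ∂μ| := by
      rw [hmean, hwdef, ← sub_div, abs_div, abs_of_pos ht]
      field_simp
    have h2 := abs_sub_le (w x) (w z) (⨍ x, w x ∂μ)
    have h3 := hpt x hx
    have h4 : C⁻¹ / 2 * (|(u x).toReal - mean μ u| / n) ≤
        2 + 2 * κ + Real.log (1 + (H x).toReal) := by
      rw [h1]
      calc C⁻¹ / 2 * (2 * |w x - ⨍ x, w x ∂μ|)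
          ≤ C⁻¹ / 2 * (2 * (C * (1 + Real.log (1 + (H x).toReal)) + C * (1 + 2 * κ))) := by
            gcongr; exact h2.trans (add_le_add h3 havg)
        _ = _ := by field_simp; ring
    have h5 : 0 < 1 + (H x).toReal := by linarith [hH0 x]
    calc ENNReal.ofReal (Real.exp (C⁻¹ / 2 * (|(u x).toReal - mean μ u| / n)))
        ≤ ENNReal.ofReal (Real.exp (2 + 2 * κ) * (1 + (H x).toReal)) := by
          apply ENNReal.ofReal_le_ofReal
          calc _ ≤ Real.exp (2 + 2 * κ + Real.log (1 + (H x).toReal)) := Real.exp_le_exp.2 h4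
            _ = _ := by rw [Real.exp_add, Real.exp_log h5]
      _ ≤ _ := by
          rw [ENNReal.ofReal_mul (by positivity), ENNReal.ofReal_add zero_le_one (hH0 x),
            ENNReal.ofReal_one]
          gcongr
          exact ENNReal.ofReal_toReal_le
  rw [laverage_eq]
  calc (∫⁻ x, ENNReal.ofReal (Real.exp (C⁻¹ / 2 * (|(u x).toReal - mean μ u| / n))) ∂μ) / μ univ
      ≤ (∫⁻ x, ENNReal.ofReal (Real.exp (2 + 2 * κ)) * (1 + H x) ∂μ) / μ univ := by
        exact ENNReal.div_le_div_right (lintegral_mono_ae hexp) _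
    _ ≤ ENNReal.ofReal (Real.exp (2 + 2 * κ)) * (μ univ + 2) / μ univ := by
        gcongr
        rw [lintegral_const_mul' _ _ ENNReal.ofReal_ne_top, lintegral_add_left measurable_const,
          lintegral_one]
        gcongr
        exact hw.lintegral_le
    _ = ENNReal.ofReal (Real.exp (2 + 2 * κ) * (μ.real univ + 2) / μ.real univ) := by
        rw [ENNReal.ofReal_div_of_pos hμr, ENNReal.ofReal_mul (by positivity),
          ENNReal.ofReal_add hμr.le (by norm_num), measureReal_def, ENNReal.ofReal_toReal hμ.ne]
        simp
    _ ≤ _ := by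
        apply ENNReal.ofReal_le_ofReal
        calc _ = Real.exp (2 + 2 * κ) * (1 + 2 * (μ.real univ)⁻¹) := by field_simp
          _ ≤ _ := by gcongr

theorem morrey_embedding (hX : Bornology.IsBounded (univ : Set X)) (hb : 0 < b) (hb1 : b ≤ 1)
    (hδ : 0 < δ) : ∃ C D : ℝ, 0 < C ∧ 0 < D ∧ ∀ μ : Measure X,
      Setting μ b δ Q p s → MuchLess μ Q (fun x => s x * p x) →
      ∀ (A : Scale) (q : X → ℝ≥0∞), AdmissibleExponent A μ p q →
        ∀ (u : X → EReal) (g : ℤ → X → ℝ≥0∞), MemHom A μ s p q u →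
          IsVectorGradient μ s u g → MemMixed A μ p q g →
          Integrable (fun x => (u x).toReal) μ ∧
          essSup (fun x => (u x - (mean μ u : EReal)).abs) μ
            ≤ ENNReal.ofReal C * mixedNorm A μ p q g ∧
          ∃ v : X → ℝ, Continuous v ∧ (∀ᵐ x ∂μ, u x = (v x : EReal)) ∧
            ∀ x y : X, |v x - v y| ≤ D * (mixedNorm A μ p q g).toReal
              * dist x y ^ (s x - Q x / p x) := by
  by_cases hex : ∃ μ : Measure X, Setting μ b δ Q p s ∧ MuchLess μ Q (fun x => s x * p x)
  swap
  · exact ⟨1, 1, one_pos, one_pos, fun μ h1 h2 => absurd ⟨μ, h1, h2⟩ hex⟩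
  obtain ⟨μ₀, hS₀, hL₀⟩ := hex
  obtain ⟨A₀, hA⟩ := hS₀.exists_slowExponents
  obtain ⟨a, ha, hL⟩ := hL₀.exists_forall hS₀.metricMeasure hS₀.Q_log.continuous
    (hS₀.s_log.continuous.mul hS₀.p_log.continuous)
  obtain ⟨d, hd⟩ := Metric.isBounded_iff.1 hX
  have hp := hS₀.p_log.bdd.pos
  have hQ := hS₀.Q_log.bdd.pos
  have hA0 := hA.pos
  have hβ : ∀ x, (p x)⁻¹ - s x * (Q x)⁻¹ ≤ -(a * (A₀⁻¹ * A₀⁻¹)) := by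
    intro x
    have h1 : (p x)⁻¹ - s x * (Q x)⁻¹ = -((s x * p x - Q x) * ((p x)⁻¹ * (Q x)⁻¹)) := by
      have := (hp x).ne'
      have := (hQ x).ne'
      field_simp
      ring
    rw [h1, neg_le_neg_iff]
    have h2 := hL x
    have h3 := (hA.P_mem x).1
    have h4 := (hA.R_mem x).1
    have h5 := (hA.P_pos x).le
    gcongr
    exact ha.le.trans h2
  have hα : ∀ x, a * A₀⁻¹ ≤ s x - Q x / p x := by
    intro x
    have h1 : s x - Q x / p x = (s x * p x - Q x) * (p x)⁻¹ := by
      have := (hp x).ne'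
      field_simp
    rw [h1]
    have h2 := hL x
    have h3 := (hA.P_mem x).1
    gcongr
    exact ha.le.trans h2
  have hαc : Continuous (fun x => s x - Q x / p x) :=
    hS₀.s_log.continuous.sub (hS₀.Q_log.continuous.div hS₀.p_log.continuous fun x => (hp x).ne')
  obtain ⟨C, hC0, hC⟩ := exists_morrey_pointwise hA (fun x y => hd (mem_univ x) (mem_univ y)) hb
    hb1 hδ (by positivity) hβ
  -- In `2 * C`, one `C` bounds `|u - c|` and the other the distance from `c` to the mean.
  refine ⟨2 * C, C, by positivity, hC0, ?_⟩
  intro μ hS _ A q hq u g hu hg hgm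
  have hμ : μ univ < ∞ := hS.metricMeasure.univ_lt_top hX
  have : IsFiniteMeasure μ := ⟨hμ⟩
  have hopen := hS.metricMeasure.isOpenPosMeasure
  have : NeZero μ := ⟨fun h => by
    have := (hS.metricMeasure (Classical.arbitrary X) 1 one_pos).1
    simp [h] at this⟩
  have hfinite := hS.mixedNorm_lt_top hq hgm
  set n := (mixedNorm A μ p q g).toReal with hn
  have hn0 : 0 ≤ n := ENNReal.toReal_nonneg
  have hum : Measurable (fun x => (u x).toReal) := hu.measurable.ereal_toReal
  have main : ∀ t : ℝ, 0 < t → mixedNorm A μ p q g < ENNReal.ofReal t →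
      ∃ N : Set X, μ N = 0 ∧ (∃ c : ℝ, ∀ x ∉ N, |(u x).toReal - c| ≤ C * t) ∧
        ∀ x ∉ N, ∀ y ∉ N, |(u x).toReal - (u y).toReal| ≤
          C * t * dist x y ^ (s x - Q x / p x) := by
    intro t ht hlt
    obtain ⟨N, H, hw, -⟩ := hS.exists_hasGradientPower hq hu hg ht hlt
    obtain ⟨⟨z, h1⟩, h2⟩ := hC μ hS.lower N H _ hw
    refine ⟨N, hw.null, ⟨(u z).toReal, fun x hx => ?_⟩, fun x hx y hy => ?_⟩
    · have := h1 x hx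
      rwa [← sub_div, abs_div, abs_of_pos ht, div_le_iff₀ ht] at this
    · have := h2 x hx y hy
      rw [← sub_div, abs_div, abs_of_pos ht, div_le_iff₀ ht] at this
      linarith
  have hint : Integrable (fun x => (u x).toReal) μ := by
    have hlt : mixedNorm A μ p q g < ENNReal.ofReal (n + 1) := by
      rw [← ENNReal.ofReal_toReal hfinite.ne, ← hn, ENNReal.ofReal_lt_ofReal_iff (by positivity)]
      linarith
    obtain ⟨N, hN, ⟨c, hc⟩, -⟩ := main (n + 1) (by positivity) hlt
    have h1 : Integrable (fun x => (u x).toReal - c) μ := by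
      refine (integrable_const (C * (n + 1))).mono' (hum.sub_const _).aestronglyMeasurable ?_
      filter_upwards [measure_eq_zero_iff_ae_notMem.1 hN] with x hx using hc x hx
    simpa only [Pi.add_def, sub_add_cancel] using h1.add (integrable_const c)
  refine ⟨hint, ?_, ?_⟩
  · refine le_mul_of_forall_lt (by positivity) fun t ht hlt => ?_
    obtain ⟨N, hN, ⟨c, hc⟩, -⟩ := main t ht hlt
    have hae : ∀ᵐ x ∂μ, |(u x).toReal - c| ≤ C * t := by
      filter_upwards [measure_eq_zero_iff_ae_notMem.1 hN] with x hx using hc x hx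
    have h1 := abs_sub_average_le hint (integrable_const (C * t)) hae
    rw [average_const] at h1
    refine essSup_le_of_ae_le _ ?_
    filter_upwards [hae, hu.ae_finite] with x hx hx'
    rw [abs_coe_sub_of_finite hx']
    apply ENNReal.ofReal_le_ofReal
    calc |(u x).toReal - mean μ u| ≤ |(u x).toReal - c| + |c - mean μ u| := abs_sub_le _ _ _
      _ ≤ C * t + C * t := add_le_add hx h1
      _ = _ := by ring
  -- The exceptional set depends on the bound `t` for the norm. Letting `t` decrease to `n` along a
  -- sequence keeps the union null and gives the exact factor `n`, also when `n = 0`.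
  · have hseq : ∀ j : ℕ, ∃ N : Set X, μ N = 0 ∧ ∀ x ∉ N, ∀ y ∉ N,
        |(u x).toReal - (u y).toReal| ≤
          C * (n + 1 / ((j : ℝ) + 1)) * dist x y ^ (s x - Q x / p x) := by
      intro j
      have hj : 0 < 1 / ((j : ℝ) + 1) := by positivity
      have hlt : mixedNorm A μ p q g < ENNReal.ofReal (n + 1 / ((j : ℝ) + 1)) := by
        rw [← ENNReal.ofReal_toReal hfinite.ne, ← hn, ENNReal.ofReal_lt_ofReal_iff (by positivity)]
        linarith
      obtain ⟨N, hN, -, h⟩ := main _ (by positivity) hlt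
      exact ⟨N, hN, h⟩
    choose N hN hNu using hseq
    have hnull : ∀ᵐ x ∂μ, x ∉ ⋃ j, N j :=
      measure_eq_zero_iff_ae_notMem.1 (measure_iUnion_null hN)
    have hdense : Dense {x | x ∉ ⋃ j, N j} := Measure.dense_of_ae hnull
    obtain ⟨v, hv, hvu, hvh⟩ := exists_continuous_extension (U := fun x => (u x).toReal) hdense hαc
      (L := C * n) (mul_pos ha (inv_pos.2 hA0)) hα (by
        intro x hx y hy
        simp only [mem_ofPred_eq, mem_iUnion, not_exists] at hx hy
        have hlim : Filter.Tendsto (fun j : ℕ => C * (n + 1 / ((j : ℝ) + 1)) *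
            dist x y ^ (s x - Q x / p x)) Filter.atTop
            (nhds (C * (n + 0) * dist x y ^ (s x - Q x / p x))) :=
          ((tendsto_one_div_add_atTop_nhds_zero_nat.const_add n).const_mul C).mul_const _
        rw [add_zero] at hlim
        exact ge_of_tendsto' hlim fun j => hNu j x (hx j) y (hy j))
    refine ⟨v, hv, ?_, hvh⟩
    filter_upwards [hnull, hu.ae_finite] with x hx hx'
    rw [hvu x hx, EReal.coe_toReal hx'.1 hx'.2]

end Embedding

end HajlaszEmbedding

theorem mainTheorem10 {X : Type*} [MetricSpace X] [Nonempty X] [MeasurableSpace X] [BorelSpace X]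
    (hX : Bornology.IsBounded (Set.univ : Set X))
    (b δ : ℝ) (hb : 0 < b) (hb1 : b ≤ 1) (hδ : 0 < δ) (Q p s : X → ℝ) :
    -- (i) Sobolev inequalities; the constant may depend on the total mass `m` of the measure
    (∀ m : ℝ≥0∞, ∃ C : ℝ, 0 < C ∧ ∀ μ : Measure X,
      HajlaszEmbedding.Setting μ b δ Q p s → μ Set.univ = m →
      HajlaszEmbedding.MuchLess μ (fun x => s x * p x) Q →
      ∀ (A : HajlaszEmbedding.Scale) (q : X → ℝ≥0∞),
        HajlaszEmbedding.AdmissibleExponent A μ p q →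
        (∀ (u : X → EReal) (g : ℤ → X → ℝ≥0∞), HajlaszEmbedding.MemHom A μ s p q u →
          HajlaszEmbedding.IsVectorGradient μ s u g → HajlaszEmbedding.MemMixed A μ p q g →
          ⨅ c : ℝ, HajlaszEmbedding.lpNorm μ (fun x => Q x * p x / (Q x - s x * p x))
              (fun x => (u x - (c : EReal)).abs)
            ≤ ENNReal.ofReal C * HajlaszEmbedding.mixedNorm A μ p q g) ∧
        (∀ (u : X → EReal) (g : ℤ → X → ℝ≥0∞), HajlaszEmbedding.MemInhom A μ s p q u →
          HajlaszEmbedding.IsVectorGradient μ s u g → HajlaszEmbedding.MemMixed A μ p q g →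
          HajlaszEmbedding.lpNorm μ (fun x => Q x * p x / (Q x - s x * p x))
              (fun x => (u x).abs)
            ≤ ENNReal.ofReal C * (HajlaszEmbedding.lpNorm μ p (fun x => (u x).abs)
                + HajlaszEmbedding.mixedNorm A μ p q g))) ∧
    -- (ii) Moser–Trudinger inequality
    (∃ C₁ C₂ : ℝ, 0 < C₁ ∧ 0 < C₂ ∧ ∀ μ : Measure X,
      HajlaszEmbedding.Setting μ b δ Q p s → (∀ x, s x * p x = Q x) →
      ∀ (A : HajlaszEmbedding.Scale) (q : X → ℝ≥0∞),
        HajlaszEmbedding.AdmissibleExponent A μ p q →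
        ∀ (u : X → EReal) (g : ℤ → X → ℝ≥0∞), HajlaszEmbedding.MemHom A μ s p q u →
          HajlaszEmbedding.IsVectorGradient μ s u g → HajlaszEmbedding.MemMixed A μ p q g →
          0 < HajlaszEmbedding.mixedNorm A μ p q g →
          Integrable (fun x => (u x).toReal) μ ∧
          ⨍⁻ x, ENNReal.ofReal (Real.exp (C₁ * (|(u x).toReal - HajlaszEmbedding.mean μ u|
              / (HajlaszEmbedding.mixedNorm A μ p q g).toReal))) ∂μ ≤ ENNReal.ofReal C₂) ∧
    -- (iii) Morrey inequality and Hölder continuity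
    (∃ C D : ℝ, 0 < C ∧ 0 < D ∧ ∀ μ : Measure X,
      HajlaszEmbedding.Setting μ b δ Q p s →
      HajlaszEmbedding.MuchLess μ Q (fun x => s x * p x) →
      ∀ (A : HajlaszEmbedding.Scale) (q : X → ℝ≥0∞),
        HajlaszEmbedding.AdmissibleExponent A μ p q →
        ∀ (u : X → EReal) (g : ℤ → X → ℝ≥0∞), HajlaszEmbedding.MemHom A μ s p q u →
          HajlaszEmbedding.IsVectorGradient μ s u g → HajlaszEmbedding.MemMixed A μ p q g →
          Integrable (fun x => (u x).toReal) μ ∧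
          essSup (fun x => (u x - (HajlaszEmbedding.mean μ u : EReal)).abs) μ
            ≤ ENNReal.ofReal C * HajlaszEmbedding.mixedNorm A μ p q g ∧
          ∃ v : X → ℝ, Continuous v ∧ (∀ᵐ x ∂μ, u x = (v x : EReal)) ∧
            ∀ x y : X, |v x - v y| ≤ D * (HajlaszEmbedding.mixedNorm A μ p q g).toReal
              * dist x y ^ (s x - Q x / p x)) := by
  exact ⟨HajlaszEmbedding.sobolev_embedding hX hb hb1 hδ,
    HajlaszEmbedding.moser_trudinger hX hb hb1 hδ, HajlaszEmbedding.morrey_embedding hX hb hb1 hδ⟩
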